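/- Let $f\in\mathcal D'(\mathbb R^d)$ be a real- or complex-valued distribution and let $x_0\in\mathbb R^d$. The distributional point value $f(x_0)$ is said to exist and equal $\gamma$ if for every test function $\phi\in\mathcal D(\mathbb R^d)$ $$\lim_{\varepsilon\to0}\langle f(x_0+\varepsilon x),\phi(x)\rangle=\gamma\int_{\mathbb R^d}\phi(x)\,dx,\qquad\text{where}\quad \langle f(x_0+\varepsilon x),\phi(x)\rangle=|\varepsilon|^{-d}\big\langle f(x),\phi\big(\tfrac{x-x_0}{\varepsilon}\big)\big\rangle\quad(\varepsilon\in\mathbb R\setminus\{0\}).$$ The standard delta sequence generated by a positive normalized test function $\phi$ (that is, $\phi\in\mathcal D(\mathbb R^d)$, $\phi\ge 0$, $\int_{\mathbb R^d}\phi\,dx=1$) is $\phi_n(x)=n^d\phi(nx)$, $n=1,2,3,\dots$. For an orthogonal transformation $T$ of $\mathbb R^d$ put $\phi_n^T(x)=\phi_n(Tx)$. Then the distributional point value $f(x_0)$ exists (that is, it exists and equals $\gamma$ for some scalar $\gamma$) if and only if, for every standard delta sequence $\{\phi_n\}_{n=1}^\infty$ generated by a positive normalized test function of $\mathcal D(\mathbb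 R^d)$, the limit $$\gamma_{\{\phi_n\}}=\lim_{n\to\infty}\langle f(x_0+x),\phi_n(x)\rangle$$ exists and, for every orthogonal transformation $T$ of $\mathbb R^d$, $\gamma_{\{\phi_n^T\}}=\gamma_{\{\phi_n\}}$. In particular, for $f\in\mathcal D'(\mathbb R)$ and $x_0\in\mathbb R$, the distributional point value $f(x_0)$ exists if and only if for every standard delta sequence $\{\phi_n\}_{n=1}^\infty$ generated by a positive normalized test function of $\mathcal D(\mathbb R)$ the limit $\gamma_{\{\phi_n(x)\}}$ exists and $\gamma_{\{\phi_n(-x)\}}=\gamma_{\{\phi_n(x)\}}$. -/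

import Mathlib

open Set Filter Topology MeasureTheory TopologicalSpace
open scoped Distributions ContDiff

noncomputable section

namespace PointValue

section Basic

variable {E : Type*} [NormedAddCommGroup E] [NormedSpace ℝ E]

/-- The test function `x ↦ φ (e x)`, for a smooth closed embedding `e` of `E` into itself (below:
translations, dilations by a nonzero factor, linear isometries). -/
def compEmb (φ : 𝓓((⊤ : Opens E), ℝ)) (e : E → E) (he : ContDiff ℝ ∞ e)
    (hc : IsClosedEmbedding e) : 𝓓((⊤ : Opens E), ℝ) where
  toFun := fun x => φ (e x)
  contDiff' := φ.contDiff.comp he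
  hasCompactSupport' := φ.hasCompactSupport.comp_isClosedEmbedding hc
  tsupport_subset' := fun _ _ => trivial

/-- The translate `x ↦ φ (x - x₀)`. -/
def translate (x₀ : E) (φ : 𝓓((⊤ : Opens E), ℝ)) : 𝓓((⊤ : Opens E), ℝ) :=
  compEmb φ (fun x => x - x₀) (contDiff_id.sub contDiff_const)
    (Homeomorph.subRight x₀).isClosedEmbedding

/-- The dilate `x ↦ φ (c x)` for `c ≠ 0`. For `c = 0`, where this function need not have compact
support, the value is `0` by convention; this value is never used. -/
def dilate (c : ℝ) (φ : 𝓓((⊤ : Opens E), ℝ)) : 𝓓((⊤ : Opens E), ℝ) :=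
  if hc : c = 0 then 0
  else compEmb φ (fun x => c • x) (contDiff_const_smul c)
    (Homeomorph.smulOfNeZero c hc).isClosedEmbedding

/-- `φ^T`, that is `x ↦ φ (T x)`, for an orthogonal transformation `T`. -/
def orthComp (T : E ≃ₗᵢ[ℝ] E) (φ : 𝓓((⊤ : Opens E), ℝ)) : 𝓓((⊤ : Opens E), ℝ) :=
  compEmb φ T T.contDiff T.toHomeomorph.isClosedEmbedding

variable {𝕜 : Type*} [RCLike 𝕜]

/-- The pairing `⟨f(x₀ + ε x), φ(x)⟩ = |ε|^(-d) ⟨f(x), φ((x - x₀) / ε)⟩`, for `ε ≠ 0`, where `d` is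
the dimension of the space. -/
def affinePairing (f : 𝓓'((⊤ : Opens E), 𝕜)) (x₀ : E) (ε : ℝ) (φ : 𝓓((⊤ : Opens E), ℝ)) : 𝕜 :=
  f ((|ε| ^ Module.finrank ℝ E)⁻¹ • translate x₀ (dilate ε⁻¹ φ))

/-- The standard delta sequence `φ_n(x) = n^d φ(n x)`, `n = 1, 2, 3, …`, generated by a normalized
test function `φ`; it is indexed from zero, so that the term of index `k` is `φ_{k+1}`. -/
def standardDeltaSeq (φ : 𝓓((⊤ : Opens E), ℝ)) (k : ℕ) : 𝓓((⊤ : Opens E), ℝ) :=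
  ((k + 1 : ℕ) : ℝ) ^ Module.finrank ℝ E • dilate ((k + 1 : ℕ) : ℝ) φ

/-- The sequence `⟨f(x₀ + x), φ_n(x)⟩ = ⟨f(x), φ_n(x - x₀)⟩` converges to `γ`. -/
def HasLimitAlong (f : 𝓓'((⊤ : Opens E), 𝕜)) (x₀ : E) (s : ℕ → 𝓓((⊤ : Opens E), ℝ)) (γ : 𝕜) :
    Prop :=
  Tendsto (fun n => f (translate x₀ (s n))) atTop (𝓝 γ)

end Basic

section Measure

variable {E : Type*} [NormedAddCommGroup E] [InnerProductSpace ℝ E] [FiniteDimensional ℝ E]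
  [MeasurableSpace E] [BorelSpace E] {𝕜 : Type*} [RCLike 𝕜]

/-- A positive (that is, nonnegative) normalized test function. -/
def IsPosNormalized (φ : 𝓓((⊤ : Opens E), ℝ)) : Prop :=
  (∀ x, 0 ≤ φ x) ∧ ∫ x, φ x = 1

/-- The standard delta sequences generated by positive normalized test functions. -/
def positiveStandardDeltaSeqs (E : Type*) [NormedAddCommGroup E] [InnerProductSpace ℝ E]
    [FiniteDimensional ℝ E] [MeasurableSpace E] [BorelSpace E] :
    Set (ℕ → 𝓓((⊤ : Opens E), ℝ)) :=
  {s | ∃ φ : 𝓓((⊤ : Opens E), ℝ), IsPosNormalized φ ∧ s = standardDeltaSeq φ}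

/-- The distributional point value `f(x₀)` exists and equals `γ`: as `ε → 0`, `ε ≠ 0`,
`f(x₀ + ε x)` tends to the constant `γ` in the sense of distributions. -/
def HasPointValue (f : 𝓓'((⊤ : Opens E), 𝕜)) (x₀ : E) (γ : 𝕜) : Prop :=
  ∀ φ : 𝓓((⊤ : Opens E), ℝ),
    Tendsto (fun ε : ℝ => affinePairing f x₀ ε φ) (𝓝[≠] 0) (𝓝 (γ * ((∫ x, φ x : ℝ) : 𝕜)))

end Measure

end PointValue

end

/-! Write `g_r(φ)` for the pairing of `f` with `r^d φ(r(x - x₀))`. The hypothesis gives limits of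
`g_n` at nonnegative test functions along integers `n`. Any test function is a difference of two
nonnegative ones, so `g_n(φ)` converges for all `φ`, with a limit invariant under orthogonal maps.
The point value asks that `g_r` converge for real `r → ∞` (and for reflected `φ`) to a constant
distribution.

From integers to reals (`exists_scaling_limit`): the spaces `𝓓_K` are Fréchet, so by
Banach–Steinhaus the `g_n` are equicontinuous on each and their limit `g` is a distribution. Writing
`r = ⌊r⌋ s` with `s → 1`, one has `g_r(φ) = g_⌊r⌋(s^d φ(s ·))`, and equicontinuity gives `g_r(φ) →
g(φ)`. Hence `g` is homogeneous of degree 0 under all positive real dilations.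

Such a `g`, being also orthogonally invariant, is constant (`exists_eq_const_mul_integral`).
Differentiating the invariances gives the Euler equation and the rotation equations, which combine
to `|x|² ∂_j g = 0`. So `∂_j g` lives at the origin, where it has degree -1; together with `g(-x) =
g(x)` this forces `∂_j g = 0` (`map_dirDeriv_eq_zero`). A distribution with zero gradient is
constant, as seen by evaluating it on a convolution in two ways (`map_convolution_eq`). -/

noncomputable section

namespace PointValue

/-! ### Completeness and the Baire property of `𝓓_K` -/

section Complete

variable {E : Type*} [NormedAddCommGroup E] [NormedSpace ℝ E]

-- If the derivatives of every order of a sequence converge uniformly, the limits form a Taylor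
-- series of the limit function, which is therefore smooth. Sequences suffice because a countable
-- product of normed spaces is first countable.
open ContDiffMapSupportedIn in
theorem isClosed_range_pi_structureMapCLM (K : Compacts E) :
    IsClosed (range (ContinuousLinearMap.pi (structureMapCLM ℝ ⊤) :
      𝓓_{K}(E, ℝ) →L[ℝ] Π i, BoundedContinuousFunction E (E [×i]→L[ℝ] ℝ))) := by
  refine isClosed_of_closure_subset fun G hG => ?_
  obtain ⟨v, hv, hlim⟩ := mem_closure_iff_seq_limit.1 hG
  choose u hu using hv
  have hunif : ∀ i, TendstoUniformly (fun n x => iteratedFDeriv ℝ i (u n) x) (G i) atTop := by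
    intro i
    have h := (tendsto_pi_nhds.1 hlim) i
    rw [BoundedContinuousFunction.tendsto_iff_tendstoUniformly] at h
    have heq : (fun n x => iteratedFDeriv ℝ i (u n) x) = fun n => ⇑(v n i) := by
      funext n x
      rw [← structureMapCLM_top_apply ℝ (i := i) (u n), ← hu n]
      rfl
    rw [heq]
    exact h
  have hsm : ∀ n, ContDiff ℝ ∞ (u n) := fun n => (u n).contDiff
  have hder : ∀ i x, HasFDerivAt (fun y => G i y) ((G (i + 1) x).curryLeft) x := by
    intro i x
    refine hasFDerivAt_of_tendstoUniformly (l := atTop)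
      (f := fun n x => iteratedFDeriv ℝ i (u n) x)
      (f' := fun n x => (iteratedFDeriv ℝ (i + 1) (u n) x).curryLeft)
      (g' := fun x => (G (i + 1) x).curryLeft) ?_ ?_ (fun y => (hunif i).tendsto_at y) x
    · have := (continuousMultilinearCurryLeftEquiv ℝ (fun _ : Fin (i + 1) => E)
        ℝ).toContinuousLinearEquiv.toContinuousLinearMap.uniformContinuous
      exact this.comp_tendstoUniformly (hunif (i + 1))
    · intro n y
      exact ((contDiff_iff_ftaylorSeries.1 (hsm n)).fderiv i (by exact_mod_cast ENat.natCast_lt_top i) y)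
  have htay : HasFTaylorSeriesUpTo ∞ (fun x => (G 0 x).curry0) (fun x i => G i x) := by
    refine ⟨fun x => rfl, fun i _ x => hder i x, fun i _ => (G i).continuous⟩
  have hK : EqOn (fun x => (G 0 x).curry0) 0 (K : Set E)ᶜ := by
    intro x hx
    have h1 := (hunif 0).tendsto_at x
    have h2 : ∀ n, iteratedFDeriv ℝ 0 (u n) x = 0 := fun n =>
      (u n).iteratedFDeriv_zero_on_compl hx
    simp only [h2] at h1
    have := tendsto_nhds_unique h1 tendsto_const_nhds
    simp [this]
  refine ⟨⟨fun x => (G 0 x).curry0, htay.contDiff, hK⟩, ?_⟩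
  funext i
  ext1 x
  have := congr_fun (structureMapCLM_top_apply ℝ (i := i)
    (⟨fun x => (G 0 x).curry0, htay.contDiff, hK⟩ : 𝓓_{K}(E, ℝ))) x
  refine this.trans ?_
  exact (htay.eq_iteratedFDeriv (by exact_mod_cast le_top) x).symm

instance completeSpace_contDiffMapSupportedIn (K : Compacts E) : CompleteSpace 𝓓_{K}(E, ℝ) := by
  have h := ContDiffMapSupportedIn.isUniformEmbedding_pi_structureMapCLM (E := E) (F := ℝ)
    (n := ⊤) (K := K) ℝ
  exact (completeSpace_iff_isComplete_range h.isUniformInducing).2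
    (isClosed_range_pi_structureMapCLM K).isComplete

instance baireSpace_contDiffMapSupportedIn (K : Compacts E) : BaireSpace 𝓓_{K}(E, ℝ) := by
  have h := ContDiffMapSupportedIn.isUniformEmbedding_pi_structureMapCLM (E := E) (F := ℝ)
    (n := ⊤) (K := K) ℝ
  have : (uniformity 𝓓_{K}(E, ℝ)).IsCountablyGenerated := by
    rw [← h.isUniformInducing.comap_uniformity]
    infer_instance
  infer_instance

end Complete

/-! ### Smooth dependence of integrals on a parameter -/

section ParametricIntegral

variable {G : Type*} [NormedAddCommGroup G] [NormedSpace ℝ G] [MeasurableSpace G] [BorelSpace G]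
  [SecondCountableTopology G]
universe u
variable {P F : Type u} [NormedAddCommGroup P] [NormedSpace ℝ P] [ProperSpace P]
  [NormedAddCommGroup F] [NormedSpace ℝ F]

theorem hasFDerivAt_setIntegral_of_contDiff {μ : Measure G} [IsFiniteMeasureOnCompacts μ]
    {k : Set G} (hk : IsCompact k) {h : G × P → F} (hh : ContDiff ℝ 1 h) (p₀ : P) :
    HasFDerivAt (fun p => ∫ a in k, h (a, p) ∂μ)
      (∫ a in k, (fderiv ℝ h (a, p₀)).comp (ContinuousLinearMap.inr ℝ G P) ∂μ) p₀ := by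
  have hD : Continuous fun q : G × P =>
      (fderiv ℝ h q).comp (ContinuousLinearMap.inr ℝ G P) :=
    (hh.continuous_fderiv one_ne_zero).clm_comp continuous_const
  obtain ⟨C, hC⟩ := (hk.prod (isCompact_closedBall p₀ 1)).exists_bound_of_continuousOn
    hD.continuousOn
  have hmeas : ∀ {X : Type u} [NormedAddCommGroup X] {w : G × P → X}, Continuous w →
      ∀ p, AEStronglyMeasurable (fun a => w (a, p)) (μ.restrict k) := fun hw p =>
    (hw.comp (Continuous.prodMk_left p)).aestronglyMeasurable
  refine hasFDerivAt_integral_of_dominated_of_fderiv_le (bound := fun _ => C)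
    (s := Metric.ball p₀ 1) (F' := fun p a => (fderiv ℝ h (a, p)).comp
      (ContinuousLinearMap.inr ℝ G P)) (Metric.ball_mem_nhds p₀ one_pos)
    (Eventually.of_forall (hmeas hh.continuous)) ?_ (hmeas hD p₀) ?_ ?_ ?_
  · exact ((hh.continuous.comp (Continuous.prodMk_left p₀)).continuousOn).integrableOn_compact hk
  · refine (ae_restrict_iff' hk.measurableSet).2 (Eventually.of_forall fun a ha p hp => ?_)
    exact hC (a, p) ⟨ha, Metric.ball_subset_closedBall hp⟩
  · exact continuous_const.continuousOn.integrableOn_compact hk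
  · refine Eventually.of_forall fun a p _ => ?_
    have h1 : HasFDerivAt h (fderiv ℝ h (a, p)) (a, p) :=
      (hh.differentiable one_ne_zero _).hasFDerivAt
    exact h1.comp p (hasFDerivAt_prodMk_right a p)

theorem fderiv_setIntegral_apply [CompleteSpace F] {μ : Measure G} [IsFiniteMeasureOnCompacts μ]
    {k : Set G} (hk : IsCompact k) {h : G × P → F} (hh : ContDiff ℝ 1 h) (p w : P) :
    fderiv ℝ (fun p => ∫ a in k, h (a, p) ∂μ) p w = ∫ a in k, fderiv ℝ h (a, p) (0, w) ∂μ := by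
  have hc : Continuous fun a => (fderiv ℝ h (a, p)).comp (ContinuousLinearMap.inr ℝ G P) :=
    ((hh.continuous_fderiv one_ne_zero).comp (Continuous.prodMk_left p)).clm_comp continuous_const
  have hint : IntegrableOn (fun a => (fderiv ℝ h (a, p)).comp (ContinuousLinearMap.inr ℝ G P)) k μ :=
    hc.continuousOn.integrableOn_compact hk
  rw [(hasFDerivAt_setIntegral_of_contDiff hk hh p).fderiv,
    ContinuousLinearMap.integral_apply hint]
  rfl

/-- Induction on the order: the derivative is an integral of the same kind with values in `P →L[ℝ]
F`. The induction changes `F` to this space, which is why `P` and `F` share a universe. -/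
theorem contDiff_setIntegral {μ : Measure G} [IsFiniteMeasureOnCompacts μ]
    {k : Set G} (hk : IsCompact k) {h : G × P → F} (hh : ContDiff ℝ ∞ h) :
    ContDiff ℝ ∞ (fun p => ∫ a in k, h (a, p) ∂μ) := by
  rw [contDiff_infty]
  intro n
  induction n generalizing F with
  | zero =>
    refine contDiff_zero.2 (continuous_iff_continuousAt.2 fun p => ?_)
    exact (hasFDerivAt_setIntegral_of_contDiff hk (hh.of_le (by simp)) p).continuousAt
  | succ n ih =>
    refine contDiff_succ_iff_hasFDerivAt.2 ⟨_, ?_, fun p =>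
      hasFDerivAt_setIntegral_of_contDiff hk (hh.of_le (by simp)) p⟩
    exact ih (h := fun q => (fderiv ℝ h q).comp (ContinuousLinearMap.inr ℝ G P))
      ((hh.fderiv_right (m := ∞) (by simp)).clm_comp contDiff_const)

end ParametricIntegral

/-! ### Smooth families of test functions and differentiation under a distribution -/

section SmoothFamily

variable {E : Type} [NormedAddCommGroup E] [NormedSpace ℝ E]

/-- A one-parameter family of test functions that is jointly smooth and has all its members
supported in the compact set `K`. -/
structure IsSmoothFamily (K : Compacts E) (φ : ℝ → 𝓓((⊤ : Opens E), ℝ)) : Prop where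
  contDiff : ContDiff ℝ ∞ fun p : ℝ × E => φ p.1 p.2
  eq_zero : ∀ t, ∀ x ∉ K, φ t x = 0

/-- The test functions `x ↦ h (t, x)`, for `h` smooth and vanishing off `ℝ × K`. -/
def sliceFamily (K : Compacts E) (h : ℝ × E → ℝ) (hh : ContDiff ℝ ∞ h)
    (h0 : ∀ t, ∀ x ∉ K, h (t, x) = 0) (t : ℝ) : 𝓓((⊤ : Opens E), ℝ) where
  toFun := fun x => h (t, x)
  contDiff' := hh.comp (contDiff_prodMk_right t)
  hasCompactSupport' := HasCompactSupport.intro K.isCompact (h0 t)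
  tsupport_subset' := fun _ _ => trivial

theorem isSmoothFamily_sliceFamily (K : Compacts E) (h : ℝ × E → ℝ) (hh : ContDiff ℝ ∞ h)
    (h0 : ∀ t, ∀ x ∉ K, h (t, x) = 0) : IsSmoothFamily K (sliceFamily K h hh h0) :=
  ⟨hh, h0⟩

@[simp] theorem sliceFamily_apply (K : Compacts E) (h : ℝ × E → ℝ) (hh : ContDiff ℝ ∞ h)
    (h0 : ∀ t, ∀ x ∉ K, h (t, x) = 0) (t : ℝ) (x : E) : sliceFamily K h hh h0 t x = h (t, x) :=
  rfl

/-- A test function that vanishes off `K`, as an element of `𝓓_K`. -/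
def toSupportedIn (K : Compacts E) (φ : 𝓓((⊤ : Opens E), ℝ)) (h : ∀ x ∉ K, φ x = 0) :
    𝓓_{K}(E, ℝ) :=
  ⟨φ, φ.contDiff, h⟩

theorem iteratedFDeriv_slice {h : ℝ × E → ℝ} (hh : ContDiff ℝ ∞ h) (i : ℕ) (t : ℝ) (x : E) :
    iteratedFDeriv ℝ i (fun y => h (t, y)) x =
      (iteratedFDeriv ℝ i h (t, x)).compContinuousLinearMap
        fun _ => ContinuousLinearMap.inr ℝ ℝ E := by
  have h1 : (fun y => h (t, y)) = (fun q => h (q + (t, 0))) ∘ ContinuousLinearMap.inr ℝ ℝ E := by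
    funext y; simp
  have h2 : ContDiff ℝ ∞ fun q => h (q + (t, 0)) := hh.comp (contDiff_id.add contDiff_const)
  rw [h1, ContinuousLinearMap.iteratedFDeriv_comp_right _ h2 x (i := i) (by exact_mod_cast le_top),
    iteratedFDeriv_comp_add_right]
  simp

/-- The `x`-derivatives are jointly continuous in `(t, x)`, hence continuous in `t` uniformly over
the compact `K`; off `K` they vanish. -/
theorem IsSmoothFamily.continuous_toSupportedIn {K : Compacts E} {φ : ℝ → 𝓓((⊤ : Opens E), ℝ)}
    (hφ : IsSmoothFamily K φ) :
    Continuous fun t => toSupportedIn K (φ t) (hφ.eq_zero t) := by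
  rw [ContDiffMapSupportedIn.continuous_iff_comp]
  intro i
  set D : ℝ → E → (E [×i]→L[ℝ] ℝ) := fun t x => iteratedFDeriv ℝ i (φ t) x with hD
  have hDc : Continuous fun p : ℝ × E => D p.1 p.2 := by
    have h1 := hφ.contDiff.continuous_iteratedFDeriv (m := i) (by exact_mod_cast le_top)
    have h2 : (fun p : ℝ × E => D p.1 p.2) = fun p =>
        ContinuousMultilinearMap.compContinuousLinearMapL (𝕜 := ℝ) (F := ℝ)
          (fun _ : Fin i => ContinuousLinearMap.inr ℝ ℝ E)
          (iteratedFDeriv ℝ i (fun p : ℝ × E => φ p.1 p.2) p) := by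
      funext p
      exact iteratedFDeriv_slice hφ.contDiff i p.1 p.2
    rw [h2]
    exact (ContinuousLinearMap.continuous _).comp h1
  have hval : ∀ t x, (ContDiffMapSupportedIn.structureMapCLM ℝ ⊤ i
      (toSupportedIn K (φ t) (hφ.eq_zero t))) x = D t x := fun t x =>
    congr_fun (ContDiffMapSupportedIn.structureMapCLM_top_apply ℝ (i := i)
      (toSupportedIn K (φ t) (hφ.eq_zero t))) x
  have hoff : ∀ t, ∀ x ∉ K, D t x = 0 := fun t x hx =>
    (toSupportedIn K (φ t) (hφ.eq_zero t)).iteratedFDeriv_zero_on_compl hx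
  refine continuous_iff_continuousAt.2 fun t₀ => ?_
  rw [ContinuousAt, BoundedContinuousFunction.tendsto_iff_tendstoUniformly,
    Metric.tendstoUniformly_iff]
  intro ε hε
  obtain ⟨v, hv, hu⟩ := K.isCompact.mem_uniformity_of_prod (f := D) (s := univ) (q := t₀)
    hDc.continuousOn (mem_univ _) (Metric.dist_mem_uniformity hε)
  rw [nhdsWithin_univ] at hv
  filter_upwards [hv] with t ht x
  simp only [Function.comp, hval]
  by_cases hx : x ∈ K
  · rw [dist_comm]
    exact hu t ht x hx
  · simpa [hoff _ x hx] using hε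

theorem IsSmoothFamily.continuous {K : Compacts E} {φ : ℝ → 𝓓((⊤ : Opens E), ℝ)}
    (hφ : IsSmoothFamily K φ) : Continuous φ :=
  (TestFunction.continuous_ofSupportedIn (Ω := (⊤ : Opens E)) (n := ⊤) (K := K)
    (F := ℝ) (fun _ _ => trivial)).comp hφ.continuous_toSupportedIn

variable [FiniteDimensional ℝ E]

/-- Hadamard's lemma in the first variable. -/
theorem exists_contDiff_slope {h : ℝ × E → ℝ} (hh : ContDiff ℝ ∞ h) (t₀ : ℝ) :
    ∃ q : ℝ × E → ℝ, ContDiff ℝ ∞ q ∧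
      (∀ t x, h (t, x) = h (t₀, x) + (t - t₀) * q (t, x)) ∧
      ∀ t x, q (t, x) = ∫ s in Icc (0 : ℝ) 1, fderiv ℝ h (t₀ + s * (t - t₀), x) (1, 0) := by
  have hD : ContDiff ℝ ∞ (fun p => fderiv ℝ h p (1, 0)) :=
    (hh.fderiv_right (m := ∞) (by simp)).clm_apply contDiff_const
  refine ⟨fun p => ∫ s in Icc (0 : ℝ) 1, fderiv ℝ h (t₀ + s * (p.1 - t₀), p.2) (1, 0),
    ?_, fun t x => ?_, fun _ _ => rfl⟩
  · exact contDiff_setIntegral (P := ℝ × E) isCompact_Icc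
      (h := fun z : ℝ × (ℝ × E) => fderiv ℝ h (t₀ + z.1 * (z.2.1 - t₀), z.2.2) (1, 0))
      (hD.comp (by fun_prop))
  · have hder : ∀ s : ℝ, HasDerivAt (fun s => h (t₀ + s * (t - t₀), x))
        ((t - t₀) * fderiv ℝ h (t₀ + s * (t - t₀), x) (1, 0)) s := by
      intro s
      have h1 : HasFDerivAt h (fderiv ℝ h (t₀ + s * (t - t₀), x)) (t₀ + s * (t - t₀), x) :=
        (hh.differentiable (by simp) _).hasFDerivAt
      have h2 : HasDerivAt (fun s : ℝ => (t₀ + s * (t - t₀), x)) ((t - t₀, 0) : ℝ × E) s :=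
        ((((hasDerivAt_id s).mul_const (t - t₀)).const_add t₀).congr_deriv (by simp)).prodMk
          (hasDerivAt_const s x)
      refine (h1.comp_hasDerivAt s h2).congr_deriv ?_
      have := (fderiv ℝ h (t₀ + s * (t - t₀), x)).map_smul (t - t₀) (1, 0)
      simpa using this
    have hint := intervalIntegral.integral_eq_sub_of_hasDerivAt (a := 0) (b := 1)
      (fun s _ => hder s) (Continuous.intervalIntegrable (continuous_const.mul
        (hD.continuous.comp (by fun_prop : Continuous fun s : ℝ => (t₀ + s * (t - t₀), x)))) _ _)
    rw [intervalIntegral.integral_const_mul, intervalIntegral.integral_of_le zero_le_one,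
      ← integral_Icc_eq_integral_Ioc] at hint
    simp only [one_mul, zero_mul, add_zero, add_sub_cancel] at hint
    linarith

/-- By Hadamard's lemma the difference quotients at `t₀` extend to a smooth family `ψ` supported in
the same `K`, with `ψ t₀ = φ'`; continuity of `g` along `ψ` is then all that is needed. -/
theorem IsSmoothFamily.hasDerivAt {𝕜 : Type*} [RCLike 𝕜] {K : Compacts E}
    {φ : ℝ → 𝓓((⊤ : Opens E), ℝ)} (hφ : IsSmoothFamily K φ) (g : 𝓓((⊤ : Opens E), ℝ) →L[ℝ] 𝕜)
    {t₀ : ℝ} {φ' : 𝓓((⊤ : Opens E), ℝ)} (hφ' : ∀ x, HasDerivAt (fun t => φ t x) (φ' x) t₀) :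
    HasDerivAt (fun t => g (φ t)) (g φ') t₀ := by
  obtain ⟨q, hq, hslope, hint⟩ := exists_contDiff_slope hφ.contDiff t₀
  have hq0 : ∀ t, ∀ x ∉ K, q (t, x) = 0 := by
    intro t x hx
    rw [hint]
    refine integral_eq_zero_of_ae (Eventually.of_forall fun s => ?_)
    set τ := t₀ + s * (t - t₀)
    have h1 : HasFDerivAt (fun p : ℝ × E => φ p.1 p.2) (fderiv ℝ (fun p : ℝ × E => φ p.1 p.2)
        (τ, x)) (τ, x) := (hφ.contDiff.differentiable (by simp) _).hasFDerivAt
    have h2 : HasDerivAt (fun s : ℝ => (s, x)) ((1, 0) : ℝ × E) τ :=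
      (hasDerivAt_id τ).prodMk (hasDerivAt_const τ x)
    have h3 := h1.comp_hasDerivAt τ h2
    have h4 : ((fun p : ℝ × E => φ p.1 p.2) ∘ fun s => (s, x)) = fun _ => 0 :=
      funext fun s => hφ.eq_zero s x hx
    rw [h4] at h3
    exact h3.unique (hasDerivAt_const τ 0)
  let ψ := sliceFamily K q hq hq0
  have hψ : IsSmoothFamily K ψ := isSmoothFamily_sliceFamily K q hq hq0
  have hψ0 : ψ t₀ = φ' := by
    ext x
    refine HasDerivAt.unique (f := fun t => φ t x) (x := t₀) ?_ (hφ' x)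
    have hc : ContinuousAt (fun t => q (t, x)) t₀ :=
      (hq.continuous.comp (Continuous.prodMk_left x)).continuousAt
    rw [hasDerivAt_iff_tendsto_slope]
    refine (hc.tendsto.mono_left nhdsWithin_le_nhds).congr' ?_
    filter_upwards [self_mem_nhdsWithin] with t ht
    have : t - t₀ ≠ 0 := sub_ne_zero.2 ht
    rw [slope_def_field, hslope t x]
    field_simp
    ring
  have hc : Tendsto (fun t => g (ψ t)) (𝓝 t₀) (𝓝 (g φ')) := by
    rw [← hψ0]
    exact (g.continuous.comp hψ.continuous).continuousAt
  rw [hasDerivAt_iff_tendsto_slope]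
  refine (hc.mono_left nhdsWithin_le_nhds).congr' ?_
  filter_upwards [self_mem_nhdsWithin] with t ht
  have h0 : t - t₀ ≠ 0 := sub_ne_zero.2 ht
  have h1 : φ t = φ t₀ + (t - t₀) • ψ t := by
    ext x
    exact hslope t x
  rw [slope_def_module, h1, map_add, map_smul, add_sub_cancel_left, smul_smul,
    inv_mul_cancel₀ h0, one_smul]

end SmoothFamily

/-! ### Rescaled pairings and their limit along real scales -/

section Basic

variable {E : Type} [NormedAddCommGroup E] [NormedSpace ℝ E] {𝕜 : Type*} [RCLike 𝕜]

@[simp] theorem translate_apply (x₀ : E) (φ : 𝓓((⊤ : Opens E), ℝ)) (x : E) :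
    translate x₀ φ x = φ (x - x₀) := rfl

theorem dilate_apply {c : ℝ} (hc : c ≠ 0) (φ : 𝓓((⊤ : Opens E), ℝ)) (x : E) :
    dilate c φ x = φ (c • x) := by
  simp only [dilate, hc, dite_false]
  rfl

@[simp] theorem orthComp_apply (T : E ≃ₗᵢ[ℝ] E) (φ : 𝓓((⊤ : Opens E), ℝ)) (x : E) :
    orthComp T φ x = φ (T x) := rfl

/-- The pairing `⟨f(x), r^d φ(r (x - x₀))⟩`. -/
def scaledPairing (f : 𝓓'((⊤ : Opens E), 𝕜)) (x₀ : E) (r : ℝ) (φ : 𝓓((⊤ : Opens E), ℝ)) : 𝕜 :=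
  f (translate x₀ (r ^ Module.finrank ℝ E • dilate r φ))

theorem scaledPairing_add (f : 𝓓'((⊤ : Opens E), 𝕜)) (x₀ : E) {r : ℝ} (hr : r ≠ 0)
    (φ ψ : 𝓓((⊤ : Opens E), ℝ)) :
    scaledPairing f x₀ r (φ + ψ) = scaledPairing f x₀ r φ + scaledPairing f x₀ r ψ := by
  simp only [scaledPairing]
  rw [← map_add]
  congr 1
  ext x
  simp [dilate_apply hr, mul_add]

theorem scaledPairing_smul (f : 𝓓'((⊤ : Opens E), 𝕜)) (x₀ : E) {r : ℝ} (hr : r ≠ 0)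
    (c : ℝ) (φ : 𝓓((⊤ : Opens E), ℝ)) :
    scaledPairing f x₀ r (c • φ) = c • scaledPairing f x₀ r φ := by
  simp only [scaledPairing]
  rw [← map_smul]
  congr 1
  ext x
  simp [dilate_apply hr, mul_left_comm]

theorem scaledPairing_mul (f : 𝓓'((⊤ : Opens E), 𝕜)) (x₀ : E) {r s : ℝ} (hr : r ≠ 0) (hs : s ≠ 0)
    (φ : 𝓓((⊤ : Opens E), ℝ)) :
    scaledPairing f x₀ r (s ^ Module.finrank ℝ E • dilate s φ) = scaledPairing f x₀ (r * s) φ := by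
  simp only [scaledPairing]
  congr 1
  ext x
  simp [dilate_apply hr, dilate_apply hs, dilate_apply (mul_ne_zero hr hs), mul_pow, smul_smul,
    mul_assoc, mul_comm]

/-- Puts the pairing at a fixed scale in the form that Banach–Steinhaus on `𝓓_K` requires. -/
theorem exists_scaledPairing_eq_clm (f : 𝓓'((⊤ : Opens E), 𝕜)) (x₀ : E) {r : ℝ} (hr : r ≠ 0)
    (K : Compacts E) :
    ∃ A : 𝓓_{K}(E, ℝ) →L[ℝ] 𝕜, ∀ φ : 𝓓_{K}(E, ℝ),
      A φ = scaledPairing f x₀ r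
        (TestFunction.ofSupportedIn (Ω := (⊤ : Opens E)) (fun _ _ => trivial) φ) := by
  let K' : Compacts E := K.map (fun x => x₀ + r⁻¹ • x) (by fun_prop)
  let L : E →L[ℝ] E := r • ContinuousLinearMap.id ℝ E
  have hsm : ∀ φ : 𝓓_{K}(E, ℝ), ContDiff ℝ ∞ fun x => φ (r • (x - x₀)) := fun φ =>
    φ.contDiff.comp (by fun_prop)
  let B : 𝓓_{K}(E, ℝ) →L[ℝ] 𝓓_{K'}(E, ℝ) :=
    ContDiffMapSupportedIn.mkCLM ℝ (fun φ x => φ (r • (x - x₀))) (fun _ _ _ => rfl)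
      (fun _ _ _ => rfl) hsm
      (by
        intro φ x hx
        refine φ.zero_on_compl fun h => hx ?_
        refine ⟨_, h, ?_⟩
        simp [smul_smul, inv_mul_cancel₀ hr])
      (by
        intro i _
        refine ⟨{i}, ‖L‖ ^ i, by positivity, fun φ x _ => ?_⟩
        have h1 : (fun x => φ (r • (x - x₀))) = fun x => (φ ∘ L) (x - x₀) := by
          funext x; simp [L]
        have h2 : ContDiff ℝ ∞ φ := φ.contDiff
        rw [h1, iteratedFDeriv_comp_sub, L.iteratedFDeriv_comp_right h2 _ (i := i)
          (by exact_mod_cast le_top)]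
        refine (ContinuousMultilinearMap.norm_compContinuousLinearMap_le _ _).trans ?_
        simp only [Finset.prod_const, Finset.card_univ, Fintype.card_fin, Finset.sup_singleton]
        rw [mul_comm]
        gcongr
        exact ContDiffMapSupportedIn.norm_iteratedFDeriv_apply_le_seminorm_top ℝ)
  let f' : 𝓓((⊤ : Opens E), ℝ) →L[ℝ] 𝕜 := f
  let C : 𝓓_{K'}(E, ℝ) →L[ℝ] 𝕜 :=
    f'.comp (TestFunction.ofSupportedInCLM ℝ (Ω := (⊤ : Opens E)) (fun _ _ => trivial))
  refine ⟨r ^ Module.finrank ℝ E • C.comp B, fun φ => ?_⟩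
  change r ^ Module.finrank ℝ E • f _ = f _
  rw [← map_smul]
  congr 1
  ext x
  simp only [translate_apply, FunLike.coe_smul, Pi.smul_apply, dilate_apply hr]
  rfl

/-- If `φ` vanishes off a closed ball about the origin then so do its dilates `s^d φ(s x)` for
`1 ≤ s`; they are parametrized here by `s = 1 + τ²`. -/
theorem exists_dilate_family [FiniteDimensional ℝ E] (φ : 𝓓((⊤ : Opens E), ℝ)) :
    ∃ (K : Compacts E) (σ : ℝ → 𝓓((⊤ : Opens E), ℝ)), IsSmoothFamily K σ ∧
      ∀ τ, σ τ = (1 + τ ^ 2) ^ Module.finrank ℝ E • dilate (1 + τ ^ 2) φ := by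
  obtain ⟨R, hR⟩ := φ.hasCompactSupport.isBounded.subset_closedBall (0 : E)
  let K : Compacts E := ⟨Metric.closedBall 0 R, isCompact_closedBall 0 R⟩
  have h0 : ∀ x ∉ K, φ x = 0 := fun x hx => image_eq_zero_of_notMem_tsupport fun h => hx (hR h)
  have h1 : ∀ τ : ℝ, 1 + τ ^ 2 ≠ 0 := fun τ => by positivity
  refine ⟨K, fun τ => (1 + τ ^ 2) ^ Module.finrank ℝ E • dilate (1 + τ ^ 2) φ, ⟨?_, ?_⟩,
    fun _ => rfl⟩
  · have : (fun p : ℝ × E => ((1 + p.1 ^ 2) ^ Module.finrank ℝ E • dilate (1 + p.1 ^ 2) φ) p.2) =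
        fun p => (1 + p.1 ^ 2) ^ Module.finrank ℝ E * φ ((1 + p.1 ^ 2) • p.2) := by
      funext p
      simp [dilate_apply (h1 p.1)]
    rw [this]
    have h2 : ContDiff ℝ ∞ φ := φ.contDiff
    fun_prop
  · intro τ x hx
    have : (1 + τ ^ 2) • x ∉ K := by
      intro h
      refine hx ?_
      have h3 : ‖(1 + τ ^ 2) • x‖ ≤ R := by simpa using mem_closedBall_zero_iff.1 h
      rw [norm_smul, Real.norm_of_nonneg (by positivity)] at h3
      refine mem_closedBall_zero_iff.2 (le_trans ?_ h3)
      nlinarith [norm_nonneg x, sq_nonneg τ]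
    simp [dilate_apply (h1 τ), h0 _ this]

/-- Convergence at integer scales implies convergence at real scales: the non-integral factor of the
scale tends to 1 and is moved onto the test function, where equicontinuity absorbs it. -/
theorem exists_scaling_limit [FiniteDimensional ℝ E] (f : 𝓓'((⊤ : Opens E), 𝕜)) (x₀ : E)
    (hconv : ∀ φ, ∃ γ, Tendsto (fun n : ℕ => scaledPairing f x₀ ((n + 1 : ℕ) : ℝ) φ) atTop (𝓝 γ)) :
    ∃ g : 𝓓((⊤ : Opens E), ℝ) →L[ℝ] 𝕜,
      ∀ φ, Tendsto (fun r : ℝ => scaledPairing f x₀ r φ) atTop (𝓝 (g φ)) := by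
  have hn : ∀ n : ℕ, ((n + 1 : ℕ) : ℝ) ≠ 0 := fun n => by positivity
  choose G hG using hconv
  choose A hA using fun (K : Compacts E) (n : ℕ) => exists_scaledPairing_eq_clm f x₀ (hn n) K
  let G' : 𝓓((⊤ : Opens E), ℝ) →ₗ[ℝ] 𝕜 :=
    { toFun := G
      map_add' := fun φ ψ => tendsto_nhds_unique (hG _) (((hG φ).add (hG ψ)).congr fun n =>
        (scaledPairing_add f x₀ (hn n) φ ψ).symm)
      map_smul' := fun c φ => tendsto_nhds_unique (hG _) (((hG φ).const_smul c).congr fun n =>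
        (scaledPairing_smul f x₀ (hn n) c φ).symm) }
  have hlim : ∀ K : Compacts E, Tendsto (fun n (φ : 𝓓_{K}(E, ℝ)) => A K n φ) atTop
      (𝓝 fun φ => G (TestFunction.ofSupportedIn (Ω := (⊤ : Opens E)) (fun _ _ => trivial) φ)) := by
    intro K
    refine tendsto_pi_nhds.2 fun φ => ?_
    simp only [hA]
    exact hG _
  have hcont : Continuous G' := by
    refine (TestFunction.continuous_iff_continuous_comp G').2 fun K hK => ?_
    exact (continuousLinearMapOfTendsto (𝕜₁ := ℝ) (𝕜₂ := ℝ) (A K) (hlim K)).continuous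
  have hequi : ∀ K, UniformEquicontinuous fun n => (A K n : 𝓓_{K}(E, ℝ) → 𝕜) := by
    intro K
    refine PolynormableSpace.banach_steinhaus (𝕜₁ := ℝ) (𝕜₂ := ℝ) (𝓕 := A K) fun φ => ?_
    exact (tendsto_pi_nhds.1 (hlim K) φ).isVonNBounded_range ℝ
  refine ⟨⟨G', hcont⟩, fun φ => ?_⟩
  obtain ⟨K, σ, hσ, hσφ⟩ := exists_dilate_family φ
  have hσ0 : σ 0 = φ := by
    ext x
    simp [hσφ, dilate_apply]
  let u : ℝ → 𝓓_{K}(E, ℝ) := fun τ => toSupportedIn K (σ τ) (hσ.eq_zero τ)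
  have hAu : ∀ n τ, A K n (u τ) = scaledPairing f x₀ (((n + 1 : ℕ) : ℝ) * (1 + τ ^ 2)) φ := by
    intro n τ
    rw [hA, ← scaledPairing_mul f x₀ (hn n) (by positivity), ← hσφ]
    rfl
  have hu : Continuous u := hσ.continuous_toSupportedIn
  -- Chosen so that `(N r + 1)(1 + τ²) = r` for `r ≥ 1`; the index `n` stands for the scale `n + 1`.
  let N : ℝ → ℕ := fun r => ⌊r⌋₊ - 1
  let τ : ℝ → ℝ := fun r => √(r / ⌊r⌋₊ - 1)
  have hN : Tendsto N atTop atTop := (tendsto_sub_atTop_nat 1).comp tendsto_nat_floor_atTop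
  have hτ : Tendsto τ atTop (𝓝 0) := by
    have h1 : Tendsto (fun r : ℝ => r / ⌊r⌋₊ - 1) atTop (𝓝 0) := by
      have := (tendsto_nat_floor_div_atTop (R := ℝ)).inv₀ one_ne_zero
      simpa [inv_div] using this.sub_const 1
    simpa [τ] using h1.sqrt
  have hr : ∀ᶠ r : ℝ in atTop, A K (N r) (u (τ r)) = scaledPairing f x₀ r φ := by
    filter_upwards [eventually_ge_atTop 1] with r hr
    have h1 : 1 ≤ ⌊r⌋₊ := Nat.one_le_floor_iff r |>.2 hr
    have h2 : ((N r + 1 : ℕ) : ℝ) = ⌊r⌋₊ := by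
      simp only [N]
      rw [Nat.sub_add_cancel h1]
    have h3 : (0 : ℝ) < ⌊r⌋₊ := by exact_mod_cast h1
    have h4 : 1 ≤ r / ⌊r⌋₊ := (one_le_div h3).2 (Nat.floor_le (by linarith))
    rw [hAu, h2, Real.sq_sqrt (by linarith)]
    congr 1
    field_simp
    ring
  refine Tendsto.congr' hr ?_
  have hbase : Tendsto (fun r => A K (N r) (u 0)) atTop (𝓝 (G φ)) := by
    have h1 : Tendsto (fun n => A K n (u 0)) atTop (𝓝 (G φ)) := by
      refine (hG φ).congr fun n => ?_
      rw [hAu]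
      simp
    exact h1.comp hN
  refine (tendsto_iff_of_dist ?_).1 hbase
  rw [Metric.tendsto_nhds]
  intro ε hε
  have h1 := (hequi K).equicontinuous (u 0) _ (Metric.dist_mem_uniformity hε)
  filter_upwards [((hu.tendsto 0).comp hτ).eventually h1] with r hr
  simpa using hr (N r)

end Basic

/-! ### Products and derivatives of test functions -/

section Operations

variable {E : Type} [NormedAddCommGroup E] [NormedSpace ℝ E]

theorem hasFDerivAt_testFunction (φ : 𝓓((⊤ : Opens E), ℝ)) (x : E) :
    HasFDerivAt φ (fderiv ℝ φ x) x :=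
  (φ.contDiff.differentiable (by simp) x).hasFDerivAt

theorem contDiff_testFunction (φ : 𝓓((⊤ : Opens E), ℝ)) : ContDiff ℝ ∞ φ := φ.contDiff

theorem contDiff_fderiv_testFunction (φ : 𝓓((⊤ : Opens E), ℝ)) : ContDiff ℝ ∞ (fderiv ℝ φ) :=
  (contDiff_testFunction φ).fderiv_right (by simp)

/-- The product of a smooth function and a test function. -/
def smoothMul (h : E → ℝ) (hh : ContDiff ℝ ∞ h) (φ : 𝓓((⊤ : Opens E), ℝ)) :
    𝓓((⊤ : Opens E), ℝ) where
  toFun := fun x => h x * φ x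
  contDiff' := hh.mul φ.contDiff
  hasCompactSupport' := φ.hasCompactSupport.mul_left
  tsupport_subset' := fun _ _ => trivial

@[simp] theorem smoothMul_apply (h : E → ℝ) (hh : ContDiff ℝ ∞ h) (φ : 𝓓((⊤ : Opens E), ℝ))
    (x : E) : smoothMul h hh φ x = h x * φ x := rfl

theorem fderiv_smoothMul (h : E → ℝ) (hh : ContDiff ℝ ∞ h) (φ : 𝓓((⊤ : Opens E), ℝ)) (x v : E) :
    fderiv ℝ (smoothMul h hh φ) x v = fderiv ℝ h x v * φ x + h x * fderiv ℝ φ x v := by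
  have h1 : HasFDerivAt h (fderiv ℝ h x) x := (hh.differentiable (by simp) x).hasFDerivAt
  have h2 : HasFDerivAt (smoothMul h hh φ) _ x := h1.mul (hasFDerivAt_testFunction φ x)
  rw [h2.fderiv]
  simp
  ring

/-- The derivative of a test function along a smooth vector field. -/
def derivAlong (V : E → E) (hV : ContDiff ℝ ∞ V) (φ : 𝓓((⊤ : Opens E), ℝ)) :
    𝓓((⊤ : Opens E), ℝ) where
  toFun := fun x => fderiv ℝ φ x (V x)
  contDiff' := (contDiff_fderiv_testFunction φ).clm_apply hV
  hasCompactSupport' := by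
    refine (φ.hasCompactSupport.fderiv (𝕜 := ℝ)).mono fun x hx h => hx ?_
    simp [h]
  tsupport_subset' := fun _ _ => trivial

@[simp] theorem derivAlong_apply (V : E → E) (hV : ContDiff ℝ ∞ V) (φ : 𝓓((⊤ : Opens E), ℝ))
    (x : E) : derivAlong V hV φ x = fderiv ℝ φ x (V x) := rfl

/-- The directional derivative of a test function. -/
def dirDeriv (v : E) (φ : 𝓓((⊤ : Opens E), ℝ)) : 𝓓((⊤ : Opens E), ℝ) :=
  derivAlong (fun _ => v) contDiff_const φ

@[simp] theorem dirDeriv_apply (v : E) (φ : 𝓓((⊤ : Opens E), ℝ)) (x : E) :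
    dirDeriv v φ x = fderiv ℝ φ x v := rfl

theorem exists_closedBall_eq_zero [FiniteDimensional ℝ E] (φ : 𝓓((⊤ : Opens E), ℝ)) :
    ∃ R, ∀ x, R < ‖x‖ → φ x = 0 := by
  obtain ⟨R, hR⟩ := φ.hasCompactSupport.isBounded.subset_closedBall (0 : E)
  refine ⟨R, fun x hx => image_eq_zero_of_notMem_tsupport fun h => ?_⟩
  exact absurd (mem_closedBall_zero_iff.1 (hR h)) (not_le.2 hx)

/-- The closed ball about the origin, as a compact set. -/
def compactBall (E : Type) [NormedAddCommGroup E] [NormedSpace ℝ E] [FiniteDimensional ℝ E]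
    (R : ℝ) : Compacts E :=
  ⟨Metric.closedBall 0 R, isCompact_closedBall 0 R⟩

theorem notMem_compactBall [FiniteDimensional ℝ E] {R : ℝ} {x : E} :
    x ∉ compactBall E R ↔ R < ‖x‖ := by
  rw [← not_le, not_iff_not]
  exact mem_closedBall_zero_iff

theorem IsSmoothFamily.map_eq_zero_of_const [FiniteDimensional ℝ E] {𝕜 : Type*} [RCLike 𝕜]
    {K : Compacts E} {σ : ℝ → 𝓓((⊤ : Opens E), ℝ)} (hσ : IsSmoothFamily K σ)
    (g : 𝓓((⊤ : Opens E), ℝ) →L[ℝ] 𝕜) (hconst : ∀ t, g (σ t) = g (σ 0)) {t₀ : ℝ}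
    {φ' : 𝓓((⊤ : Opens E), ℝ)} (hφ' : ∀ x, HasDerivAt (fun t => σ t x) (φ' x) t₀) : g φ' = 0 := by
  have h := hσ.hasDerivAt g hφ'
  simp only [hconst] at h
  exact h.unique (hasDerivAt_const _ _)

end Operations

/-! ### Hyperplane reflections and infinitesimal rotations -/

section Reflection

variable {E : Type} [NormedAddCommGroup E] [InnerProductSpace ℝ E]

theorem contDiff_inner_left (a : E) : ContDiff ℝ ∞ fun x : E => inner ℝ a x :=
  contDiff_const.inner ℝ contDiff_id

/-- The infinitesimal rotation in the plane of `u` and `v`. -/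
def rotationField (u v x : E) : E := inner ℝ u x • v - inner ℝ v x • u

theorem contDiff_rotationField (u v : E) : ContDiff ℝ ∞ (rotationField u v) :=
  ((contDiff_inner_left u).smul contDiff_const).sub ((contDiff_inner_left v).smul contDiff_const)

/-- The orthogonal reflection in the hyperplane orthogonal to a unit vector `a`. -/
def hyperplaneReflection (a : E) : E ≃ₗᵢ[ℝ] E := (ℝ ∙ a)ᗮ.reflection

theorem hyperplaneReflection_apply {a : E} (ha : ‖a‖ = 1) (x : E) :
    hyperplaneReflection a x = x - (2 * inner ℝ a x) • a := by
  rw [hyperplaneReflection, Submodule.reflection_orthogonal_apply,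
    Submodule.reflection_singleton_apply]
  simp [ha, mul_smul, ofNat_smul_eq_nsmul]

end Reflection

/-! ### Infinitesimal forms of homogeneity and rotation invariance -/

section Invariant

variable {E : Type} [NormedAddCommGroup E] [InnerProductSpace ℝ E] [FiniteDimensional ℝ E]
  {𝕜 : Type*} [RCLike 𝕜]

/-- A distribution homogeneous of degree `0` is annihilated by the adjoint Euler operator. -/
theorem map_euler_eq_zero {g : 𝓓((⊤ : Opens E), ℝ) →L[ℝ] 𝕜}
    (hdil : ∀ c : ℝ, 0 < c → ∀ φ, g (c ^ Module.finrank ℝ E • dilate c φ) = g φ)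
    (φ : 𝓓((⊤ : Opens E), ℝ)) :
    g ((Module.finrank ℝ E : ℝ) • φ + derivAlong (fun x => x) contDiff_id φ) = 0 := by
  set d := Module.finrank ℝ E
  obtain ⟨R, hR⟩ := exists_closedBall_eq_zero φ
  -- A curve of dilation factors through 1 with speed 1/2 that never drops below 1/2, so that for
  -- all real `t` the dilates are supported in one ball.
  let s : ℝ → ℝ := fun t => 1 + Real.sin t / 2
  have hs : ∀ t, 1 / 2 ≤ s t := fun t => by
    have := Real.neg_one_le_sin t
    simp only [s]; linarith
  have hsd : ContDiff ℝ ∞ s := contDiff_const.add (Real.contDiff_sin.div_const 2)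
  have hs0 : s 0 = 1 := by simp [s]
  have hs' : HasDerivAt s (1 / 2) 0 := by
    have := ((Real.hasDerivAt_sin 0).div_const 2).const_add 1
    simpa [s] using this
  have hφ := contDiff_testFunction φ
  let σ := sliceFamily (compactBall E (2 * R)) (fun p : ℝ × E => s p.1 ^ d * φ (s p.1 • p.2))
    (by fun_prop) (by
      intro t x hx
      rw [notMem_compactBall] at hx
      have : R < ‖s t • x‖ := by
        rw [norm_smul, Real.norm_of_nonneg (by linarith [hs t])]
        nlinarith [hs t, norm_nonneg x]
      simp [hR _ this])
  have hσφ : ∀ t, σ t = s t ^ d • dilate (s t) φ := fun t => by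
    ext x
    have : s t ≠ 0 := by linarith [hs t]
    simp [σ, dilate_apply this]
  have hσ : IsSmoothFamily (compactBall E (2 * R)) σ := isSmoothFamily_sliceFamily _ _ _ _
  have key := hσ.map_eq_zero_of_const g (t₀ := 0)
    (φ' := (1 / 2 : ℝ) • ((d : ℝ) • φ + derivAlong (fun x => x) contDiff_id φ)) ?_ ?_
  · rw [map_smul] at key
    exact (smul_eq_zero.1 key).resolve_left (by norm_num)
  · intro t
    rw [hσφ, hσφ, hdil _ (by linarith [hs t]), hdil _ (by linarith [hs 0])]
  · intro x
    have h1 : HasDerivAt (fun t => s t • x) ((1 / 2 : ℝ) • x) 0 := hs'.smul_const x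
    have h2 : HasDerivAt (fun t => φ (s t • x)) _ 0 :=
      (hasFDerivAt_testFunction φ (s 0 • x)).comp_hasDerivAt 0 h1
    refine ((hs'.pow d).mul h2).congr_deriv ?_
    simp [hs0]
    ring

/-- The infinitesimal form of rotation invariance. -/
theorem map_rotation_eq_zero {g : 𝓓((⊤ : Opens E), ℝ) →L[ℝ] 𝕜}
    (hrot : ∀ (T : E ≃ₗᵢ[ℝ] E) φ, g (orthComp T φ) = g φ)
    {u v : E} (hu : ‖u‖ = 1) (hv : ‖v‖ = 1) (huv : inner ℝ u v = 0) (φ : 𝓓((⊤ : Opens E), ℝ)) :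
    g (derivAlong (rotationField u v) (contDiff_rotationField u v) φ) = 0 := by
  obtain ⟨R, hR⟩ := exists_closedBall_eq_zero φ
  -- Reflecting in the hyperplane orthogonal to `a t`, then in the one orthogonal to `u`, is the
  -- rotation by `-2t` in the plane of `u` and `v`; hence the factor `-2` below.
  let a : ℝ → E := fun t => Real.cos t • u + Real.sin t • v
  have hvu : inner ℝ v u = 0 := by rw [real_inner_comm, huv]
  have ha : ∀ t, ‖a t‖ = 1 := by
    intro t
    have : ‖a t‖ ^ 2 = 1 := by
      rw [← real_inner_self_eq_norm_sq]
      simp only [a, inner_add_left, inner_add_right, inner_smul_left, inner_smul_right, huv, hvu,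
        real_inner_self_eq_norm_sq, hu, hv]
      simp
      linarith [Real.sin_sq_add_cos_sq t]
    nlinarith [norm_nonneg (a t)]
  have ha0 : a 0 = u := by simp [a]
  have had : ContDiff ℝ ∞ a := by
    have h1 := Real.contDiff_cos (n := ∞)
    have h2 := Real.contDiff_sin (n := ∞)
    fun_prop
  have ha' : HasDerivAt a v 0 := by
    have := ((Real.hasDerivAt_cos 0).smul_const u).add ((Real.hasDerivAt_sin 0).smul_const v)
    refine this.congr_deriv ?_
    simp
  have hin : ContDiff ℝ ∞ fun p : ℝ × E => inner ℝ (a p.1) p.2 :=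
    (had.comp contDiff_fst).inner ℝ contDiff_snd
  let S := hyperplaneReflection u
  have hS : ContDiff ℝ ∞ S := S.contDiff
  have hφ := contDiff_testFunction φ
  let T : ℝ → E ≃ₗᵢ[ℝ] E := fun t => (hyperplaneReflection (a t)).trans S
  have hT : ∀ t x, T t x = S (x - (2 * inner ℝ (a t) x) • a t) := fun t x => by
    simp [T, hyperplaneReflection_apply (ha t)]
  let σ := sliceFamily (compactBall E R)
    (fun p : ℝ × E => φ (S (p.2 - (2 * inner ℝ (a p.1) p.2) • a p.1)))
    (by fun_prop) (by
      intro t x hx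
      rw [notMem_compactBall] at hx
      rw [← hT]
      exact hR _ (by simpa using hx))
  have hσφ : ∀ t, σ t = orthComp (T t) φ := fun t => by
    ext x
    simp [σ, hT]
  have hσ : IsSmoothFamily (compactBall E R) σ := isSmoothFamily_sliceFamily _ _ _ _
  have key := hσ.map_eq_zero_of_const g (t₀ := 0) (φ' := (-2 : ℝ) •
    derivAlong (rotationField u v) (contDiff_rotationField u v) φ) ?_ ?_
  · rw [map_smul] at key
    exact (smul_eq_zero.1 key).resolve_left (by norm_num)
  · intro t
    rw [hσφ, hσφ, hrot, hrot]
  · intro x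
    have h0 : HasDerivAt (fun t => 2 * inner ℝ (a t) x) (2 * inner ℝ v x) 0 := by
      have := (ha'.inner ℝ (hasDerivAt_const (0 : ℝ) x)).const_mul 2
      simpa using this
    have h1 : HasDerivAt (fun t => x - (2 * inner ℝ (a t) x) • a t)
        (-((2 * inner ℝ u x) • v + (2 * inner ℝ v x) • u)) 0 := by
      have := (h0.smul ha').const_sub x
      simpa [ha0] using this
    have h2 : HasDerivAt (fun t => T t x) (S (-((2 * inner ℝ u x) • v + (2 * inner ℝ v x) • u)))
        0 := by
      simp only [hT]
      exact (S.toContinuousLinearEquiv.toContinuousLinearMap.hasFDerivAt).comp_hasDerivAt 0 h1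
    have hT0 : T 0 x = x := by
      rw [hT, ← hyperplaneReflection_apply (ha 0), ha0]
      exact Submodule.reflection_reflection _ _
    have h3 : HasDerivAt (fun t => σ t x) (fderiv ℝ φ (T 0 x)
        (S (-((2 * inner ℝ u x) • v + (2 * inner ℝ v x) • u)))) 0 := by
      simp only [hσφ, orthComp_apply]
      exact (hasFDerivAt_testFunction φ (T 0 x)).comp_hasDerivAt 0 h2
    refine h3.congr_deriv ?_
    rw [hT0, hyperplaneReflection_apply hu, FunLike.coe_smul, Pi.smul_apply, derivAlong_apply,
      ← map_smul, rotationField]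
    congr 1
    simp only [inner_neg_right, inner_add_right, inner_smul_right, huv,
      real_inner_self_eq_norm_sq, hu]
    module

/-- `|x|² ∂_j g = 0` for `g` homogeneous of degree `0` and rotation invariant. -/
theorem map_dirDeriv_normSq_mul_eq_zero {g : 𝓓((⊤ : Opens E), ℝ) →L[ℝ] 𝕜}
    (hdil : ∀ c : ℝ, 0 < c → ∀ φ, g (c ^ Module.finrank ℝ E • dilate c φ) = g φ)
    (hrot : ∀ (T : E ≃ₗᵢ[ℝ] E) φ, g (orthComp T φ) = g φ)
    {ι : Type*} [Fintype ι] (b : OrthonormalBasis ι ℝ E) (j : ι) (φ : 𝓓((⊤ : Opens E), ℝ)) :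
    g (dirDeriv (b j) (smoothMul (fun x => ‖x‖ ^ 2) (contDiff_norm_sq ℝ) φ)) = 0 := by
  let m : ι → 𝓓((⊤ : Opens E), ℝ) := fun i => smoothMul (fun x => inner ℝ (b i) x) (contDiff_inner_left _) φ
  have hfd : ∀ i x w, fderiv ℝ (m i) x w = inner ℝ (b i) w * φ x + inner ℝ (b i) x *
      fderiv ℝ φ x w := fun i x w => by
    rw [fderiv_smoothMul]
    have : HasFDerivAt (fun x : E => inner ℝ (b i) x) (innerSL ℝ (b i)) x :=
      (innerSL ℝ (b i)).hasFDerivAt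
    rw [this.fderiv]
    rfl
  have hrot' : ∀ i, g (derivAlong (rotationField (b i) (b j))
          (contDiff_rotationField _ _) (m i)) = 0 := by
    intro i
    by_cases hij : i = j
    · have : derivAlong (rotationField (b i) (b j))
          (contDiff_rotationField _ _) (m i) = 0 := by
        ext x
        simp [hij, rotationField]
      rw [this, map_zero]
    · exact map_rotation_eq_zero hrot (b.orthonormal.1 i) (b.orthonormal.1 j)
        (b.orthonormal.2 hij) _
  -- The adjoint form of `|x|² ∂_j = x_j ∑ x_i ∂_i + ∑ x_i (x_i ∂_j - x_j ∂_i)`.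
  have hsum : dirDeriv (b j) (smoothMul (fun x => ‖x‖ ^ 2) (contDiff_norm_sq ℝ) φ) =
      ((Module.finrank ℝ E : ℝ) • m j + derivAlong (fun x => x) contDiff_id (m j)) +
      ∑ i, derivAlong (rotationField (b i) (b j))
          (contDiff_rotationField _ _) (m i) := by
    ext x
    have hnorm : ∑ i, inner ℝ (b i) x * inner ℝ (b i) x = ‖x‖ ^ 2 := by
      rw [← b.sum_sq_inner_right x]
      exact Finset.sum_congr rfl fun i _ => (sq _).symm
    have hrepr : ∑ i, inner ℝ (b i) x * fderiv ℝ φ x (b i) = fderiv ℝ φ x x := by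
      have h := congr_arg (fderiv ℝ φ x) (b.sum_repr' x)
      rw [map_sum] at h
      simpa using h
    have hcard : (Module.finrank ℝ E : ℝ) = ∑ _i : ι, (1 : ℝ) := by
      rw [Module.finrank_eq_card_basis b.toBasis]; simp
    have hfn : fderiv ℝ (fun y : E => ‖y‖ ^ 2) x (b j) = 2 * inner ℝ (b j) x := by
      rw [(hasStrictFDerivAt_norm_sq x).hasFDerivAt.fderiv]
      simp [real_inner_comm]
    have hdelta : ∑ i, inner ℝ (b i) x * inner ℝ (b i) (b j) = inner ℝ (b j) x := by
      classical
      simp [b.inner_eq_ite]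
    have hterm : ∀ i, fderiv ℝ (m i) x (rotationField (b i) (b j) x) =
        (inner ℝ (b i) x * inner ℝ (b i) (b j)) * φ x +
          (inner ℝ (b i) x * inner ℝ (b i) x) * fderiv ℝ φ x (b j)
          - 1 * (inner ℝ (b j) x * φ x)
          - inner ℝ (b j) x * (inner ℝ (b i) x * fderiv ℝ φ x (b i)) := by
      intro i
      have : inner ℝ (b i) (b i) = (1 : ℝ) := by
        rw [real_inner_self_eq_norm_sq, b.orthonormal.1 i]; norm_num
      rw [rotationField, map_sub, map_smul, map_smul, hfd, hfd, this]
      simp only [smul_eq_mul]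
      ring
    simp only [FunLike.coe_add, FunLike.coe_smul, FunLike.coe_sum, Pi.add_apply, Pi.smul_apply,
      Finset.sum_apply, derivAlong_apply, dirDeriv_apply, fderiv_smoothMul, hterm, hfn, hfd,
      Finset.sum_sub_distrib, Finset.sum_add_distrib, ← Finset.sum_mul, ← Finset.mul_sum,
      hnorm, hrepr, hdelta, ← hcard]
    simp only [m, smoothMul_apply, smul_eq_mul]
    ring
  rw [hsum, map_add, map_euler_eq_zero hdil, map_sum, Finset.sum_eq_zero fun i _ => hrot' i,
    add_zero]

end Invariant

/-! ### Vanishing of the gradient, at the origin included -/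

section Invariant

variable {E : Type} [NormedAddCommGroup E] [InnerProductSpace ℝ E] [FiniteDimensional ℝ E]
  {𝕜 : Type*} [RCLike 𝕜]

/-- A radial cutoff function. -/
theorem exists_even_cutoff (E : Type) [NormedAddCommGroup E] [InnerProductSpace ℝ E]
    [FiniteDimensional ℝ E] {R : ℝ} (hR : 0 < R) :
    ∃ χ : 𝓓((⊤ : Opens E), ℝ), (∀ x, 0 ≤ χ x) ∧ (∀ x, χ (-x) = χ x) ∧ ∀ x, ‖x‖ ≤ R → χ x = 1 := by
  let B : ContDiffBump (0 : E) := ⟨R, R + 1, hR, by linarith⟩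
  refine ⟨⟨B, B.contDiff, B.hasCompactSupport, fun _ _ => trivial⟩, fun x => B.nonneg,
    fun x => B.neg x, fun x hx => B.one_of_mem_closedBall (mem_closedBall_zero_iff.2 hx)⟩

/-- Away from the origin one may divide by `|x|²`: here `φ / |x|²` is again a test function. -/
theorem map_dirDeriv_eq_zero_of_eventuallyEq {g : 𝓓((⊤ : Opens E), ℝ) →L[ℝ] 𝕜}
    (hdil : ∀ c : ℝ, 0 < c → ∀ φ, g (c ^ Module.finrank ℝ E • dilate c φ) = g φ)
    (hrot : ∀ (T : E ≃ₗᵢ[ℝ] E) φ, g (orthComp T φ) = g φ)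
    {ι : Type*} [Fintype ι] (b : OrthonormalBasis ι ℝ E) (j : ι) (φ : 𝓓((⊤ : Opens E), ℝ))
    (h0 : ∀ᶠ x in 𝓝 0, φ x = 0) : g (dirDeriv (b j) φ) = 0 := by
  let ψ : 𝓓((⊤ : Opens E), ℝ) :=
    { toFun := fun x => (‖x‖ ^ 2)⁻¹ * φ x
      contDiff' := by
        refine contDiff_iff_contDiffAt.2 fun x => ?_
        rcases eq_or_ne x 0 with rfl | hx
        · refine contDiffAt_const (c := (0 : ℝ)) |>.congr_of_eventuallyEq ?_
          filter_upwards [h0] with y hy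
          simp [hy]
        · exact ((contDiff_norm_sq ℝ).contDiffAt.inv (by simpa using hx)).mul
            φ.contDiff.contDiffAt
      hasCompactSupport' := φ.hasCompactSupport.mul_left
      tsupport_subset' := fun _ _ => trivial }
  have hφψ : φ = smoothMul (fun x => ‖x‖ ^ 2) (contDiff_norm_sq ℝ) ψ := by
    ext x
    change φ x = ‖x‖ ^ 2 * ((‖x‖ ^ 2)⁻¹ * φ x)
    rcases eq_or_ne x 0 with rfl | hx
    · simpa using h0.self_of_nhds
    · field_simp
  rw [hφψ]
  exact map_dirDeriv_normSq_mul_eq_zero hdil hrot b j ψ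

/-- Derivatives of order `m` of the delta function have degree `-d - m`, so `∂_j g`, of degree -1
and supported at 0, could only be a multiple of delta with `d = 1`, and this is not odd. The proof
makes this quantitative and needs no structure theorem: `φ` is cut off to `χ(kx) φ(x)`, rescaled to
`ζ_{1/k}(x) = φ(x/k) χ(x)`, and `k → ∞`. -/
theorem map_dirDeriv_eq_zero {g : 𝓓((⊤ : Opens E), ℝ) →L[ℝ] 𝕜}
    (hdil : ∀ c : ℝ, 0 < c → ∀ φ, g (c ^ Module.finrank ℝ E • dilate c φ) = g φ)
    (hrot : ∀ (T : E ≃ₗᵢ[ℝ] E) φ, g (orthComp T φ) = g φ)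
    {ι : Type*} [Fintype ι] (b : OrthonormalBasis ι ℝ E) (j : ι) (φ : 𝓓((⊤ : Opens E), ℝ)) :
    g (dirDeriv (b j) φ) = 0 := by
  set d := Module.finrank ℝ E with hd
  have hd1 : 1 ≤ d := by
    have := Fintype.card_pos_iff.2 ⟨j⟩
    rw [hd, Module.finrank_eq_card_basis b.toBasis]
    exact this
  obtain ⟨χ, -, hχe, hχ1⟩ := exists_even_cutoff E one_pos
  obtain ⟨R, hR⟩ := exists_closedBall_eq_zero χ
  have hφ := contDiff_testFunction φ
  have hχ := contDiff_testFunction χ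
  let ζ : ℝ → 𝓓((⊤ : Opens E), ℝ) := fun t => smoothMul (fun x : E => φ (t • x)) (by fun_prop) χ
  have hζ : ∀ (t : ℝ) (x : E), HasFDerivAt (fun y => φ (t • y)) (t • fderiv ℝ φ (t • x)) x := by
    intro t x
    have h1 : HasFDerivAt (fun y : E => t • y) (t • ContinuousLinearMap.id ℝ E) x :=
      (hasFDerivAt_id x).const_smul t
    refine ((hasFDerivAt_testFunction φ (t • x)).comp x h1).congr_fderiv ?_
    ext v
    simp
  have hζ' : ∀ t x, dirDeriv (b j) (ζ t) x =
      t * fderiv ℝ φ (t • x) (b j) * χ x + φ (t • x) * fderiv ℝ χ x (b j) := by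
    intro t x
    rw [dirDeriv_apply, fderiv_smoothMul, (hζ t x).fderiv]
    simp
  have hfam : IsSmoothFamily (compactBall E R) fun t => dirDeriv (b j) (ζ t) := by
    refine ⟨?_, fun t x hx => ?_⟩
    · simp only [hζ']
      have h1 := contDiff_fderiv_testFunction φ
      have h2 := contDiff_fderiv_testFunction χ
      have h3 : ContDiff ℝ ∞ fun p : ℝ × E => fderiv ℝ φ (p.1 • p.2) (b j) :=
        (h1.comp (contDiff_fst.smul contDiff_snd)).clm_apply contDiff_const
      have h4 : ContDiff ℝ ∞ fun p : ℝ × E => fderiv ℝ χ p.2 (b j) :=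
        (h2.comp contDiff_snd).clm_apply contDiff_const
      fun_prop
    · rw [notMem_compactBall] at hx
      have h1 : χ =ᶠ[𝓝 x] fun _ => 0 := by
        filter_upwards [(isOpen_lt continuous_const continuous_norm).mem_nhds hx] with y hy
        exact hR y hy
      rw [hζ', hR x hx, h1.fderiv_eq]
      simp
  -- `ζ 0 = φ(0) χ` is even, so its derivative is odd, while `g` is invariant under `x ↦ -x`. For `d
  -- = 1` this is what rules out the Heaviside function.
  have hodd : g (dirDeriv (b j) (ζ 0)) = 0 := by
    have h1 : orthComp (LinearIsometryEquiv.neg ℝ) (dirDeriv (b j) (ζ 0)) =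
        -dirDeriv (b j) (ζ 0) := by
      ext x
      have h2 : (fun y => χ (-y)) = χ := funext hχe
      have h3 : fderiv ℝ χ (-x) (b j) = -fderiv ℝ χ x (b j) := by
        have h4 : HasFDerivAt (fun y => χ (-y)) _ x :=
          (hasFDerivAt_testFunction χ (-x)).comp x (hasFDerivAt_id x).neg
        rw [h2] at h4
        rw [h4.fderiv]
        simp
      change dirDeriv (b j) (ζ 0) (-x) = -dirDeriv (b j) (ζ 0) x
      simp only [hζ', h3, hχe]
      simp
    have h2 := hrot (LinearIsometryEquiv.neg ℝ) (dirDeriv (b j) (ζ 0))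
    rw [h1, map_neg] at h2
    exact self_eq_neg.1 h2.symm
  have hlim : Tendsto (fun n : ℕ => ‖g (dirDeriv (b j) (ζ ((n : ℝ) + 1)⁻¹))‖) atTop (𝓝 0) := by
    have h1 := ((g.continuous.comp hfam.continuous).norm.tendsto 0).comp
      ((tendsto_inv_atTop_zero (𝕜 := ℝ)).comp
        (tendsto_atTop_add_const_right _ (1 : ℝ) tendsto_natCast_atTop_atTop))
    simpa [Function.comp_def, hodd] using h1
  -- Homogeneity gives the factor `k^d` on the left, the chain rule only `k` on the right; `k ≤ k^d`
  -- because `d ≥ 1`.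
  have hle : ∀ n : ℕ, ‖g (dirDeriv (b j) φ)‖ ≤ ‖g (dirDeriv (b j) (ζ ((n : ℝ) + 1)⁻¹))‖ := by
    intro n
    set k : ℝ := (n : ℝ) + 1 with hk
    have hk1 : 1 ≤ k := by simp [hk]
    have hk0 : k ≠ 0 := by positivity
    let η : 𝓓((⊤ : Opens E), ℝ) := smoothMul (fun x : E => χ (k • x)) (by fun_prop) φ
    have hη : g (dirDeriv (b j) φ) = g (dirDeriv (b j) η) := by
      have h1 := map_dirDeriv_eq_zero_of_eventuallyEq hdil hrot b j (φ - η) (by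
        have h2 : ∀ᶠ x : E in 𝓝 0, ‖k • x‖ < 1 :=
          (continuous_const_smul k).norm.continuousAt.eventually_lt continuousAt_const (by simp)
        filter_upwards [h2] with x hx
        simp [η, hχ1 _ hx.le])
      have h2 : dirDeriv (b j) (φ - η) = dirDeriv (b j) φ - dirDeriv (b j) η := by
        ext x
        have := ((hasFDerivAt_testFunction φ x).sub (hasFDerivAt_testFunction η x)).fderiv
        simp only [FunLike.coe_sub, Pi.sub_apply, dirDeriv_apply, this]
      rw [h2, map_sub] at h1
      exact sub_eq_zero.1 h1
    have hηζ : k ^ d • dirDeriv (b j) η = k • k ^ d • dilate k (dirDeriv (b j) (ζ k⁻¹)) := by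
      ext x
      have h1 : HasFDerivAt (fun y => χ (k • y)) (k • fderiv ℝ χ (k • x)) x := by
        have h1 : HasFDerivAt (fun y : E => k • y) (k • ContinuousLinearMap.id ℝ E) x :=
          (hasFDerivAt_id x).const_smul k
        refine ((hasFDerivAt_testFunction χ (k • x)).comp x h1).congr_fderiv ?_
        ext v
        simp
      simp only [FunLike.coe_smul, Pi.smul_apply, dilate_apply hk0, hζ', dirDeriv_apply, η,
        fderiv_smoothMul, h1.fderiv, smul_smul, inv_mul_cancel₀ hk0, one_smul, smul_eq_mul]
      field_simp
      ring
    have h2 : k ^ d • g (dirDeriv (b j) η) = k • g (dirDeriv (b j) (ζ k⁻¹)) := by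
      rw [← map_smul, hηζ, map_smul, hdil k (by positivity)]
    have h3 : k ^ d * ‖g (dirDeriv (b j) η)‖ = k * ‖g (dirDeriv (b j) (ζ k⁻¹))‖ := by
      have := congr_arg norm h2
      rwa [norm_smul, norm_smul, Real.norm_of_nonneg (by positivity),
        Real.norm_of_nonneg (by positivity)] at this
    rw [hη]
    have h4 : k ≤ k ^ d := le_self_pow₀ hk1 (by omega)
    have h5 : k * ‖g (dirDeriv (b j) η)‖ ≤ k * ‖g (dirDeriv (b j) (ζ k⁻¹))‖ :=
      (mul_le_mul_of_nonneg_right h4 (norm_nonneg _)).trans h3.le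
    exact le_of_mul_le_mul_left h5 (by positivity)
  exact norm_le_zero_iff.1 (ge_of_tendsto' hlim hle)

end Invariant

/-! ### Distributions with zero gradient are constant -/

section Translate

variable {E : Type} [NormedAddCommGroup E] [NormedSpace ℝ E]

theorem fderiv_mul_comp_sub_smul {φ ρ : 𝓓((⊤ : Opens E), ℝ)} {s : ℝ → ℝ}
    (hs : ContDiff ℝ ∞ s) (q : E × (ℝ × E)) (w : ℝ × E) :
    fderiv ℝ (fun q : E × (ℝ × E) => φ q.1 * ρ (q.2.2 - s q.2.1 • q.1)) q (0, w) =
      φ q.1 * fderiv ℝ ρ (q.2.2 - s q.2.1 • q.1) (w.2 - (deriv s q.2.1 * w.1) • q.1) := by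
  obtain ⟨a, t, x⟩ := q
  have hφ := contDiff_testFunction φ
  have hρ := contDiff_testFunction ρ
  have hsm : ContDiff ℝ ∞ fun q : E × (ℝ × E) => φ q.1 * ρ (q.2.2 - s q.2.1 • q.1) := by fun_prop
  have h0 := (hsm.differentiable (by simp) (a, t, x)).hasFDerivAt
  have hs' : HasDerivAt s (deriv s t) t := (hs.differentiable (by simp) t).hasDerivAt
  have h1 : HasDerivAt (fun τ : ℝ => s (t + τ * w.1)) (deriv s t * w.1) 0 := by
    have h2 : HasDerivAt (fun τ : ℝ => t + τ * w.1) w.1 0 :=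
      (((hasDerivAt_id (0 : ℝ)).mul_const w.1).const_add t).congr_deriv (by simp)
    have h3 : HasDerivAt s (deriv s t) (t + 0 * w.1) := by simpa using hs'
    exact h3.comp 0 h2
  have h2 : HasDerivAt (fun τ : ℝ => (x + τ • w.2) - s (t + τ * w.1) • a)
      (w.2 - (deriv s t * w.1) • a) 0 := by
    have h3 : HasDerivAt (fun τ : ℝ => x + τ • w.2) w.2 0 :=
      (((hasDerivAt_id (0 : ℝ)).smul_const w.2).const_add x).congr_deriv (by simp)
    exact h3.sub (h1.smul_const a)
  have h3 : HasDerivAt (fun τ : ℝ => φ a * ρ ((x + τ • w.2) - s (t + τ * w.1) • a))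
      (φ a * fderiv ℝ ρ (x - s t • a) (w.2 - (deriv s t * w.1) • a)) 0 := by
    have h4 := ((hasFDerivAt_testFunction ρ
      ((x + (0 : ℝ) • w.2) - s (t + 0 * w.1) • a)).comp_hasDerivAt 0 h2).const_mul (φ a)
    simpa using h4
  have h4 : HasDerivAt (fun τ : ℝ => ((a, t + τ * w.1, x + τ • w.2) : E × ℝ × E)) (0, w) 0 := by
    refine (hasDerivAt_const (0 : ℝ) a).prodMk (HasDerivAt.prodMk ?_ ?_)
    · exact (((hasDerivAt_id (0 : ℝ)).mul_const w.1).const_add t).congr_deriv (by simp)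
    · exact (((hasDerivAt_id (0 : ℝ)).smul_const w.2).const_add x).congr_deriv (by simp)
  have h0' : HasFDerivAt (fun q : E × (ℝ × E) => φ q.1 * ρ (q.2.2 - s q.2.1 • q.1))
      (fderiv ℝ (fun q : E × (ℝ × E) => φ q.1 * ρ (q.2.2 - s q.2.1 • q.1)) (a, t, x))
      (a, t + 0 * w.1, x + (0 : ℝ) • w.2) := by simpa using h0
  have h5 := HasFDerivAt.comp_hasDerivAt
    (f := fun τ : ℝ => ((a, t + τ * w.1, x + τ • w.2) : E × ℝ × E)) 0 h0' h4
  exact h5.unique h3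

end Translate

section Convolution

variable {E : Type} [NormedAddCommGroup E] [InnerProductSpace ℝ E] [FiniteDimensional ℝ E]
  [MeasurableSpace E] [BorelSpace E] {𝕜 : Type*} [RCLike 𝕜]

/-- The derivative of `(t, x) ↦ ∫ φ(a) ρ(x - s(t) a) da`. -/
theorem fderiv_integral_mul_comp_sub_smul {φ ρ : 𝓓((⊤ : Opens E), ℝ)} {s : ℝ → ℝ}
    (hs : ContDiff ℝ ∞ s) (K : Compacts E) (p w : ℝ × E) :
    fderiv ℝ (fun p : ℝ × E => ∫ a in K, φ a * ρ (p.2 - s p.1 • a)) p w =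
      ∫ a in K, φ a * fderiv ℝ ρ (p.2 - s p.1 • a) (w.2 - (deriv s p.1 * w.1) • a) := by
  have hφ := contDiff_testFunction φ
  have hρ := contDiff_testFunction ρ
  have hsm : ContDiff ℝ ∞ fun q : E × (ℝ × E) => φ q.1 * ρ (q.2.2 - s q.2.1 • q.1) := by fun_prop
  refine (fderiv_setIntegral_apply (μ := volume) (P := ℝ × E) K.isCompact
    (hsm.of_le (m := 1) (by simp)) p w).trans ?_
  refine integral_congr_ae (Eventually.of_forall fun a => ?_)
  exact fderiv_mul_comp_sub_smul hs (a, p) w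

/-- The convolution of two test functions, as the endpoint of a path that starts at a multiple of
`ρ`, along which a translation invariant distribution is constant. -/
theorem map_convolution_eq {g : 𝓓((⊤ : Opens E), ℝ) →L[ℝ] 𝕜}
    {ι : Type*} [Fintype ι] (b : OrthonormalBasis ι ℝ E)
    (hg : ∀ j φ, g (dirDeriv (b j) φ) = 0) (φ ρ ψ : 𝓓((⊤ : Opens E), ℝ))
    (hψ : ∀ x, ψ x = ∫ a, φ a * ρ (x - a)) : g ψ = (∫ a, φ a) • g ρ := by
  obtain ⟨R, hR⟩ := exists_closedBall_eq_zero φ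
  obtain ⟨R', hR'⟩ := exists_closedBall_eq_zero ρ
  have hsin : ContDiff ℝ ∞ Real.sin := Real.contDiff_sin
  -- The factor `sin t` runs from 0 at `t = 0` to 1 at `t = π/2` and stays bounded by 1, so that all
  -- members of the family, for real `t`, are supported in one ball.
  let I : 𝓓((⊤ : Opens E), ℝ) → ℝ × E → ℝ := fun φ p =>
    ∫ a in compactBall E R, φ a * ρ (p.2 - Real.sin p.1 • a)
  have hρ := contDiff_testFunction ρ
  have hI : ∀ φ, ContDiff ℝ ∞ (I φ) := fun φ => by
    have hφ := contDiff_testFunction φ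
    exact contDiff_setIntegral (μ := volume) (P := ℝ × E) (compactBall E R).isCompact
      (h := fun q : E × (ℝ × E) => φ q.1 * ρ (q.2.2 - Real.sin q.2.1 • q.1)) (by fun_prop)
  have hI0 : ∀ φ t, ∀ x ∉ compactBall E (R + R'), I φ (t, x) = 0 := by
    intro φ t x hx
    rw [notMem_compactBall] at hx
    refine setIntegral_eq_zero_of_forall_eq_zero fun a ha => ?_
    have ha' : ‖a‖ ≤ R := mem_closedBall_zero_iff.1 ha
    have h1 : ‖Real.sin t • a‖ ≤ R := by
      rw [norm_smul]
      exact (mul_le_of_le_one_left (norm_nonneg a) (Real.abs_sin_le_one t)).trans ha'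
    have h2 : R' < ‖x - Real.sin t • a‖ := by
      have := norm_sub_norm_le x (Real.sin t • a)
      linarith
    simp only [hR' _ h2, mul_zero]
  let σ : 𝓓((⊤ : Opens E), ℝ) → ℝ → 𝓓((⊤ : Opens E), ℝ) := fun φ =>
    sliceFamily (compactBall E (R + R')) (I φ) (hI φ) (hI0 φ)
  let m : ι → 𝓓((⊤ : Opens E), ℝ) := fun i =>
    smoothMul (fun x => inner ℝ (b i) x) (contDiff_inner_left _) φ
  have hder : ∀ t, HasDerivAt (fun t => g (σ φ t)) 0 t := by
    intro t
    have h1 := (isSmoothFamily_sliceFamily (compactBall E (R + R')) (I φ) (hI φ)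
      (hI0 φ)).hasDerivAt g (t₀ := t)
      -- Expanding `a` in the basis turns the `t`-derivative into `x`-derivatives of the same
      -- integrals with `φ(a)` replaced by `a_i φ(a)`; `g` annihilates these.
      (φ' := (-Real.cos t) • ∑ i, dirDeriv (b i) (σ (m i) t)) ?_
    · refine h1.congr_deriv ?_
      rw [map_smul, map_sum, Finset.sum_eq_zero fun i _ => hg i _, smul_zero]
    · intro x
      have h2 : HasDerivAt (fun t => I φ (t, x)) (fderiv ℝ (I φ) (t, x) (1, 0)) t :=
        HasFDerivAt.comp_hasDerivAt (f := fun t : ℝ => (t, x)) t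
          ((hI φ).differentiable (by simp) (t, x)).hasFDerivAt
          ((hasDerivAt_id t).prodMk (hasDerivAt_const t x))
      refine h2.congr_deriv ?_
      have h3 : ∀ i, dirDeriv (b i) (σ (m i) t) x = ∫ a in compactBall E R,
          inner ℝ (b i) a * φ a * fderiv ℝ ρ (x - Real.sin t • a) (b i) := by
        intro i
        have h4 : HasFDerivAt (fun y : E => I (m i) (t, y)) _ x :=
          (((hI (m i)).differentiable (by simp) (t, x)).hasFDerivAt).comp x
            (hasFDerivAt_prodMk_right t x)
        have h5 : dirDeriv (b i) (σ (m i) t) x = fderiv ℝ (I (m i)) (t, x) (0, b i) := by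
          rw [dirDeriv_apply]
          exact congr_arg (fun L : E →L[ℝ] ℝ => L (b i)) h4.fderiv
        rw [h5, fderiv_integral_mul_comp_sub_smul hsin]
        simp [m]
      simp only [FunLike.coe_smul, FunLike.coe_sum, Pi.smul_apply, Finset.sum_apply, h3]
      have hint : ∀ i, IntegrableOn (fun a => inner ℝ (b i) a * φ a *
          fderiv ℝ ρ (x - Real.sin t • a) (b i)) (compactBall E R) := by
        intro i
        refine Continuous.continuousOn ?_ |>.integrableOn_compact (compactBall E R).isCompact
        have h6 := (contDiff_fderiv_testFunction ρ).continuous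
        have h7 := φ.continuous
        fun_prop
      rw [fderiv_integral_mul_comp_sub_smul hsin, ← integral_finsetSum _ fun i _ => hint i,
        smul_eq_mul, ← integral_const_mul]
      refine integral_congr_ae (Eventually.of_forall fun a => ?_)
      have h8 := congr_arg (fderiv ℝ ρ (x - Real.sin t • a)) (b.sum_repr' a)
      rw [map_sum] at h8
      simp only [map_smul, smul_eq_mul] at h8
      simp only [mul_one, zero_sub, map_neg, map_smul, Real.deriv_sin, smul_eq_mul]
      rw [← h8, Finset.mul_sum, ← Finset.sum_neg_distrib, Finset.mul_sum, Finset.mul_sum]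
      refine Finset.sum_congr rfl fun i _ => ?_
      ring
  have hconst := is_const_of_deriv_eq_zero (fun t => (hder t).differentiableAt)
    (fun t => (hder t).deriv) (Real.pi / 2) 0
  have hset : ∀ F : E → ℝ, (∫ a in compactBall E R, φ a * F a) = ∫ a, φ a * F a := by
    intro F
    refine setIntegral_eq_integral_of_forall_compl_eq_zero fun a ha => ?_
    rw [hR a (notMem_compactBall.1 ha), zero_mul]
  have h1 : σ φ (Real.pi / 2) = ψ := by
    ext x
    simp [σ, I, hset, hψ]
  have h0 : σ φ 0 = (∫ a, φ a) • ρ := by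
    ext x
    simp [σ, I, hset, integral_mul_const]
  rw [h1, h0, map_smul] at hconst
  exact hconst

/-- A distribution that is homogeneous of degree `0` and invariant under orthogonal
transformations is a constant function. -/
theorem exists_eq_const_mul_integral {g : 𝓓((⊤ : Opens E), ℝ) →L[ℝ] 𝕜}
    (hdil : ∀ c : ℝ, 0 < c → ∀ φ, g (c ^ Module.finrank ℝ E • dilate c φ) = g φ)
    (hrot : ∀ (T : E ≃ₗᵢ[ℝ] E) φ, g (orthComp T φ) = g φ) :
    ∃ γ : 𝕜, ∀ φ, g φ = γ * ((∫ x, φ x : ℝ) : 𝕜) := by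
  let b := stdOrthonormalBasis ℝ E
  have hg : ∀ j φ, g (dirDeriv (b j) φ) = 0 := map_dirDeriv_eq_zero hdil hrot b
  let B : ContDiffBump (0 : E) := ⟨1, 2, one_pos, one_lt_two⟩
  let ρ : 𝓓((⊤ : Opens E), ℝ) :=
    ⟨B.normed volume, B.contDiff_normed, B.hasCompactSupport_normed, fun _ _ => trivial⟩
  have hρ : ∫ x, ρ x = 1 := B.integral_normed
  refine ⟨g ρ, fun φ => ?_⟩
  obtain ⟨R, hR⟩ := exists_closedBall_eq_zero φ
  obtain ⟨R', hR'⟩ := exists_closedBall_eq_zero ρ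
  have hsm : ContDiff ℝ ∞ fun x => ∫ a in compactBall E R, φ a * ρ (x - a) := by
    have h1 := contDiff_testFunction φ
    have h2 := contDiff_testFunction ρ
    exact contDiff_setIntegral (μ := volume) (P := E) (compactBall E R).isCompact
      (h := fun q : E × E => φ q.1 * ρ (q.2 - q.1)) (by fun_prop)
  have hset : ∀ x, (∫ a in compactBall E R, φ a * ρ (x - a)) = ∫ a, φ a * ρ (x - a) := by
    intro x
    refine setIntegral_eq_integral_of_forall_compl_eq_zero fun a ha => ?_
    rw [hR a (notMem_compactBall.1 ha), zero_mul]
  let ψ : 𝓓((⊤ : Opens E), ℝ) :=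
    { toFun := fun x => ∫ a in compactBall E R, φ a * ρ (x - a)
      contDiff' := hsm
      hasCompactSupport' := by
        refine HasCompactSupport.intro (compactBall E (R + R')).isCompact fun x hx => ?_
        have hx' := notMem_compactBall.1 hx
        refine setIntegral_eq_zero_of_forall_eq_zero fun a ha => ?_
        have ha' : ‖a‖ ≤ R := mem_closedBall_zero_iff.1 ha
        have h2 : R' < ‖x - a‖ := by linarith [norm_sub_norm_le x a]
        rw [hR' _ h2, mul_zero]
      tsupport_subset' := fun _ _ => trivial }
  -- Convolution is commutative, so `g(φ * ρ)` equals both `(∫ φ) g(ρ)` and `(∫ ρ) g(φ) = g(φ)`.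
  have h1 := map_convolution_eq b hg φ ρ ψ hset
  have h2 := map_convolution_eq b hg ρ φ ψ fun x => by
    refine (hset x).trans ?_
    rw [← integral_sub_left_eq_self (fun a => φ a * ρ (x - a)) volume x]
    refine integral_congr_ae (Eventually.of_forall fun a => ?_)
    simp [mul_comm]
  rw [hρ, one_smul] at h2
  rw [← h2, h1, RCLike.real_smul_eq_coe_mul, mul_comm]

end Convolution

/-! ### Delta sequences and signed scales as rescaled pairings -/

section Sequences

variable {E : Type} [NormedAddCommGroup E] [NormedSpace ℝ E] {𝕜 : Type*} [RCLike 𝕜]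

theorem orthComp_standardDeltaSeq (T : E ≃ₗᵢ[ℝ] E) (φ : 𝓓((⊤ : Opens E), ℝ)) (n : ℕ) :
    orthComp T (standardDeltaSeq φ n) = standardDeltaSeq (orthComp T φ) n := by
  have hn : ((n + 1 : ℕ) : ℝ) ≠ 0 := by positivity
  ext x
  simp only [standardDeltaSeq, orthComp_apply, FunLike.coe_smul, Pi.smul_apply, dilate_apply hn,
    map_smul]

theorem hasLimitAlong_standardDeltaSeq_iff {f : 𝓓'((⊤ : Opens E), 𝕜)} {x₀ : E}
    {φ : 𝓓((⊤ : Opens E), ℝ)} {γ : 𝕜} :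
    HasLimitAlong f x₀ (standardDeltaSeq φ) γ ↔
      Tendsto (fun n : ℕ => scaledPairing f x₀ ((n + 1 : ℕ) : ℝ) φ) atTop (𝓝 γ) :=
  Iff.rfl

theorem affinePairing_of_pos (f : 𝓓'((⊤ : Opens E), 𝕜)) (x₀ : E) {ε : ℝ} (hε : 0 < ε)
    (φ : 𝓓((⊤ : Opens E), ℝ)) : affinePairing f x₀ ε φ = scaledPairing f x₀ ε⁻¹ φ := by
  simp only [affinePairing, scaledPairing]
  congr 1
  ext x
  simp [dilate_apply (inv_ne_zero hε.ne'), abs_of_pos hε]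

theorem affinePairing_of_neg (f : 𝓓'((⊤ : Opens E), 𝕜)) (x₀ : E) {ε : ℝ} (hε : ε < 0)
    (φ : 𝓓((⊤ : Opens E), ℝ)) :
    affinePairing f x₀ ε φ =
      scaledPairing f x₀ (-ε)⁻¹ (orthComp (LinearIsometryEquiv.neg ℝ) φ) := by
  simp only [affinePairing, scaledPairing]
  congr 1
  ext x
  have h : (-ε)⁻¹ ≠ 0 := inv_ne_zero (neg_ne_zero.2 hε.ne)
  simp only [FunLike.coe_smul, Pi.smul_apply, translate_apply, dilate_apply (inv_ne_zero hε.ne),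
    dilate_apply h, orthComp_apply, abs_of_neg hε, inv_pow]
  simp [inv_neg]

end Sequences

/-! ### The characterization of point values -/

section Characterization

variable {E : Type} [NormedAddCommGroup E] [InnerProductSpace ℝ E] [FiniteDimensional ℝ E]
  [MeasurableSpace E] [BorelSpace E] {𝕜 : Type*} [RCLike 𝕜]

theorem integral_orthComp (T : E ≃ₗᵢ[ℝ] E) (φ : 𝓓((⊤ : Opens E), ℝ)) :
    ∫ x, orthComp T φ x = ∫ x, φ x :=
  T.measurePreserving.integral_comp T.toHomeomorph.measurableEmbedding φ

theorem HasPointValue.tendsto_scaledPairing {f : 𝓓'((⊤ : Opens E), 𝕜)} {x₀ : E} {γ : 𝕜}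
    (h : HasPointValue f x₀ γ) (φ : 𝓓((⊤ : Opens E), ℝ)) :
    Tendsto (fun n : ℕ => scaledPairing f x₀ ((n + 1 : ℕ) : ℝ) φ) atTop
      (𝓝 (γ * ((∫ x, φ x : ℝ) : 𝕜))) := by
  have h1 : Tendsto (fun n : ℕ => (((n + 1 : ℕ) : ℝ))⁻¹) atTop (𝓝[≠] 0) := by
    refine tendsto_nhdsWithin_iff.2 ⟨?_, Eventually.of_forall fun n => ?_⟩
    · exact (tendsto_inv_atTop_zero (𝕜 := ℝ)).comp
        ((tendsto_natCast_atTop_atTop (R := ℝ)).comp (tendsto_add_atTop_nat 1))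
    · exact inv_ne_zero (by positivity : ((n + 1 : ℕ) : ℝ) ≠ 0)
  refine ((h φ).comp h1).congr fun n => ?_
  rw [Function.comp, affinePairing_of_pos f x₀ (by positivity), inv_inv]

/-- If the limits exist and are invariant under orthogonal transformations for positive normalized
test functions, then so for all test functions. -/
theorem exists_tendsto_scaledPairing {f : 𝓓'((⊤ : Opens E), 𝕜)} {x₀ : E}
    (h : ∀ s ∈ positiveStandardDeltaSeqs E, ∃ γ : 𝕜, HasLimitAlong f x₀ s γ ∧
      ∀ T : E ≃ₗᵢ[ℝ] E, HasLimitAlong f x₀ (fun n => orthComp T (s n)) γ)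
    (φ : 𝓓((⊤ : Opens E), ℝ)) :
    ∃ γ : 𝕜, Tendsto (fun n : ℕ => scaledPairing f x₀ ((n + 1 : ℕ) : ℝ) φ) atTop (𝓝 γ) ∧
      ∀ T : E ≃ₗᵢ[ℝ] E, Tendsto (fun n : ℕ => scaledPairing f x₀ ((n + 1 : ℕ) : ℝ) (orthComp T φ))
        atTop (𝓝 γ) := by
  have hn : ∀ n : ℕ, ((n + 1 : ℕ) : ℝ) ≠ 0 := fun n => by positivity
  have hpos : ∀ ψ : 𝓓((⊤ : Opens E), ℝ), (∀ x, 0 ≤ ψ x) → (∃ x, ψ x ≠ 0) →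
      ∃ γ : 𝕜, Tendsto (fun n : ℕ => scaledPairing f x₀ ((n + 1 : ℕ) : ℝ) ψ) atTop (𝓝 γ) ∧
      ∀ T : E ≃ₗᵢ[ℝ] E, Tendsto (fun n : ℕ => scaledPairing f x₀ ((n + 1 : ℕ) : ℝ) (orthComp T ψ))
        atTop (𝓝 γ) := by
    intro ψ hψ hne
    have hI : 0 < ∫ x, ψ x := by
      obtain ⟨x, hx⟩ := hne
      exact ψ.continuous.integral_pos_of_hasCompactSupport_nonneg_nonzero ψ.hasCompactSupport hψ hx
    set c := ∫ x, ψ x with hc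
    obtain ⟨γ, h1, h2⟩ := h (standardDeltaSeq (c⁻¹ • ψ)) ⟨c⁻¹ • ψ, ⟨fun x => by
      simpa using mul_nonneg (inv_nonneg.2 hI.le) (hψ x), by
      simp only [FunLike.coe_smul, Pi.smul_apply, smul_eq_mul]
      rw [integral_const_mul, ← hc, inv_mul_cancel₀ hI.ne']⟩, rfl⟩
    have hcψ : ψ = c • c⁻¹ • ψ := by rw [smul_smul, mul_inv_cancel₀ hI.ne', one_smul]
    refine ⟨c • γ, ?_, fun T => ?_⟩
    · rw [hcψ]
      simp only [scaledPairing_smul f x₀ (hn _) c]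
      exact (hasLimitAlong_standardDeltaSeq_iff.1 h1).const_smul c
    · have h3 := h2 T
      simp only [orthComp_standardDeltaSeq] at h3
      have hcT : orthComp T ψ = c • orthComp T (c⁻¹ • ψ) := by
        conv_lhs => rw [hcψ]
        rfl
      rw [hcT]
      simp only [scaledPairing_smul f x₀ (hn _) c]
      exact (hasLimitAlong_standardDeltaSeq_iff.1 h3).const_smul c
  obtain ⟨R, hR⟩ := exists_closedBall_eq_zero φ
  -- The cutoff needs a positive radius, and `R` may fail to be positive.
  obtain ⟨χ, hχ0, -, hχ1⟩ := exists_even_cutoff E (R := max R 1) (by positivity)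
  obtain ⟨M, hM⟩ := φ.continuous.bounded_above_of_compact_support φ.hasCompactSupport
  have hM0 : 0 ≤ M := (norm_nonneg _).trans (hM 0)
  have hχ00 : χ 0 = 1 := hχ1 0 (by simp)
  -- With `M + 1` in place of `M` the sum is at least 1 at the origin, so it can be normalized even
  -- when `φ` is zero.
  obtain ⟨γ₁, h1, h1'⟩ := hpos (φ + (M + 1) • χ) (fun x => by
    have h2 := abs_le.1 (hM x)
    simp only [FunLike.coe_add, FunLike.coe_smul, Pi.add_apply, Pi.smul_apply, smul_eq_mul]
    by_cases hx : R < ‖x‖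
    · rw [hR x hx]
      have := hχ0 x
      positivity
    · rw [hχ1 x ((not_lt.1 hx).trans (le_max_left _ _))]
      linarith) ⟨0, by
    have h2 := abs_le.1 (hM 0)
    simp only [FunLike.coe_add, FunLike.coe_smul, Pi.add_apply, Pi.smul_apply, smul_eq_mul, hχ00]
    linarith⟩
  obtain ⟨γ₂, h2, h2'⟩ := hpos χ hχ0 ⟨0, by rw [hχ00]; exact one_ne_zero⟩
  have hφ : φ = (φ + (M + 1) • χ) + (-(M + 1)) • χ := by
    rw [neg_smul]; abel
  refine ⟨γ₁ + (-(M + 1)) • γ₂, ?_, fun T => ?_⟩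
  · rw [hφ]
    simp only [scaledPairing_add f x₀ (hn _), scaledPairing_smul f x₀ (hn _) (-(M + 1))]
    simp only [← scaledPairing_add f x₀ (hn _)]
    exact h1.add (h2.const_smul _)
  · have hφT : orthComp T φ = orthComp T (φ + (M + 1) • χ) + (-(M + 1)) • orthComp T χ := by
      conv_lhs => rw [hφ]
      rfl
    rw [hφT]
    simp only [scaledPairing_add f x₀ (hn _) _ ((-(M + 1)) • orthComp T χ),
      scaledPairing_smul f x₀ (hn _) (-(M + 1))]
    exact (h1' T).add ((h2' T).const_smul _)

/-- Limits being unique, a single `γ` for the sequence and all its rotated versions expresses both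
existence and equality of the limits. -/
theorem exists_hasPointValue_iff (f : 𝓓'((⊤ : Opens E), 𝕜)) (x₀ : E) :
    (∃ γ : 𝕜, HasPointValue f x₀ γ) ↔
      ∀ s ∈ positiveStandardDeltaSeqs E, ∃ γ : 𝕜, HasLimitAlong f x₀ s γ ∧
        ∀ T : E ≃ₗᵢ[ℝ] E, HasLimitAlong f x₀ (fun n => orthComp T (s n)) γ := by
  constructor
  · rintro ⟨γ, hγ⟩ s ⟨φ, ⟨-, hφ⟩, rfl⟩
    refine ⟨γ, ?_, fun T => ?_⟩
    · have := hγ.tendsto_scaledPairing φ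
      rw [hφ] at this
      simpa using hasLimitAlong_standardDeltaSeq_iff.2 this
    · have := hγ.tendsto_scaledPairing (orthComp T φ)
      rw [integral_orthComp, hφ] at this
      simp only [orthComp_standardDeltaSeq]
      simpa using hasLimitAlong_standardDeltaSeq_iff.2 this
  · intro h
    have hlim := exists_tendsto_scaledPairing h
    obtain ⟨g, hg⟩ := exists_scaling_limit f x₀ fun φ => (hlim φ).imp fun _ h => h.1
    have hcast : Tendsto (fun n : ℕ => ((n + 1 : ℕ) : ℝ)) atTop atTop :=
      tendsto_natCast_atTop_atTop.comp (tendsto_add_atTop_nat 1)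
    have hrot : ∀ (T : E ≃ₗᵢ[ℝ] E) φ, g (orthComp T φ) = g φ := by
      intro T φ
      obtain ⟨γ, h1, h2⟩ := hlim φ
      rw [tendsto_nhds_unique ((hg _).comp hcast) (h2 T), tendsto_nhds_unique ((hg _).comp hcast) h1]
    -- Replacing `r` by `rc` does not change a limit over real scales; a limit along integers would
    -- not give this for every real `c`.
    have hdil : ∀ c : ℝ, 0 < c → ∀ φ, g (c ^ Module.finrank ℝ E • dilate c φ) = g φ := by
      intro c hc φ
      refine tendsto_nhds_unique (hg _) ?_
      refine ((hg φ).comp (tendsto_id.atTop_mul_const hc)).congr' ?_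
      filter_upwards [eventually_ne_atTop 0] with r hr
      exact (scaledPairing_mul f x₀ hr hc.ne' φ).symm
    obtain ⟨γ, hγ⟩ := exists_eq_const_mul_integral hdil hrot
    refine ⟨γ, fun φ => ?_⟩
    rw [← hγ, ← Iio_union_Ioi, nhdsWithin_union, tendsto_sup]
    constructor
    -- For `ε < 0` the sign is moved onto `φ`, where invariance under `x ↦ -x` removes it.
    · rw [← hrot (LinearIsometryEquiv.neg ℝ) φ]
      have h1 : Tendsto (fun ε : ℝ => (-ε)⁻¹) (𝓝[<] 0) atTop := by
        refine tendsto_inv_nhdsGT_zero.comp ?_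
        simpa using tendsto_neg_nhdsLT (a := (0 : ℝ))
      refine ((hg _).comp h1).congr' ?_
      filter_upwards [self_mem_nhdsWithin] with ε hε
      exact (affinePairing_of_neg f x₀ hε φ).symm
    · refine ((hg φ).comp tendsto_inv_nhdsGT_zero).congr' ?_
      filter_upwards [self_mem_nhdsWithin] with ε hε
      exact (affinePairing_of_pos f x₀ hε φ).symm

theorem linearIsometryEquiv_real_eq (T : ℝ ≃ₗᵢ[ℝ] ℝ) : (∀ x, T x = x) ∨ ∀ x, T x = -x := by
  have hT : ∀ x, T x = x * T 1 := fun x => by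
    simpa using T.map_smul x 1
  have h1 : |T 1| = 1 := by
    rw [← Real.norm_eq_abs, T.norm_map, norm_one]
  rcases eq_or_eq_neg_of_abs_eq h1 with h | h
  · exact Or.inl fun x => by rw [hT, h, mul_one]
  · exact Or.inr fun x => by rw [hT, h, mul_neg_one]

theorem exists_hasPointValue_real_iff (f : 𝓓'((⊤ : Opens ℝ), 𝕜)) (x₀ : ℝ) :
    (∃ γ : 𝕜, HasPointValue f x₀ γ) ↔
      ∀ s ∈ positiveStandardDeltaSeqs ℝ, ∃ γ : 𝕜, HasLimitAlong f x₀ s γ ∧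
        HasLimitAlong f x₀ (fun n => orthComp (LinearIsometryEquiv.neg ℝ) (s n)) γ := by
  rw [exists_hasPointValue_iff]
  refine forall₂_congr fun s _ => exists_congr fun γ => and_congr_right fun hγ =>
    ⟨fun h => h _, fun h T => ?_⟩
  rcases linearIsometryEquiv_real_eq T with hT | hT
  · have : (fun n => orthComp T (s n)) = s := by
      funext n
      ext x
      simp [hT]
    rwa [this]
  · have : (fun n => orthComp T (s n)) =
        fun n => orthComp (LinearIsometryEquiv.neg ℝ) (s n) := by
      funext n
      ext x
      simp [hT]
    rwa [this]

end Characterization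

end PointValue

end

theorem proposition6p2 {𝕜 : Type*} [RCLike 𝕜] :
    (∀ (d : ℕ) (f : 𝓓'((⊤ : Opens (EuclideanSpace ℝ (Fin d))), 𝕜))
        (x₀ : EuclideanSpace ℝ (Fin d)),
      (∃ γ : 𝕜, PointValue.HasPointValue f x₀ γ) ↔
        ∀ s ∈ PointValue.positiveStandardDeltaSeqs (EuclideanSpace ℝ (Fin d)),
          ∃ γ : 𝕜, PointValue.HasLimitAlong f x₀ s γ ∧
            ∀ T : EuclideanSpace ℝ (Fin d) ≃ₗᵢ[ℝ] EuclideanSpace ℝ (Fin d),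
              PointValue.HasLimitAlong f x₀ (fun n => PointValue.orthComp T (s n)) γ) ∧
    (∀ (f : 𝓓'((⊤ : Opens ℝ), 𝕜)) (x₀ : ℝ),
      (∃ γ : 𝕜, PointValue.HasPointValue f x₀ γ) ↔
        ∀ s ∈ PointValue.positiveStandardDeltaSeqs ℝ,
          ∃ γ : 𝕜, PointValue.HasLimitAlong f x₀ s γ ∧
            PointValue.HasLimitAlong f x₀
              (fun n => PointValue.orthComp (LinearIsometryEquiv.neg ℝ) (s n)) γ) := by
  exact ⟨fun _ f x₀ => PointValue.exists_hasPointValue_iff f x₀,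
    PointValue.exists_hasPointValue_real_iff⟩
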